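/- Let $N$ be a nondegenerate (not almost surely constant) random variable with values in $\{0,1,2,\dots\}$, $P(N=0)=0$ and $E[N\log N]<\infty$; put $a=E[N]\in(1,\infty)$ and $\mu=\min\{n: P(N=n)>0\}$, and assume $\mu=1$, that is, $p_1=P(N=1)>0$. Let $(Z_n)_{n\ge 0}$ be the generation sizes of a Galton--Watson tree with offspring law that of $N$: $Z_0=1$ and $Z_{n+1}=\sum_{i=1}^{Z_n}\xi_{n,i}$, where the $\xi_{n,i}$ are independent copies of $N$. Let $W=\lim_{n\to\infty}Z_n/a^n$ be the martingale limit, $K=\min\{k: Z_k>\mu^k\}=\min\{k: Z_k>1\}$, and $\gamma(\varepsilon)=\log(1/\varepsilon)/\log a$. Then, almost surely, the limit $W$ exists and is strictly positive and $K$ is finite; moreover $P(W<\varepsilon)>0$ for every $\varepsilon>0$, and there exists $\lambda>0$ such that $$\limsup_{\varepsilon\downarrow 0} P\big(|K-\gamma(\varepsilon)|\ge x \,\big|\, W<\varepsilon\big)\le e^{-\lambda x}\qquad\text{for all real } x\ge 1 .$$ -/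

import Mathlib

open MeasureTheory ProbabilityTheory Filter Topology

namespace GaltonWatson

/-- Generation sizes of the Galton-Watson tree in which the `i`-th individual of generation `n` has
`ξ n i` children: `Z_0 = 1` and `Z_{n+1} = ∑_{i < Z_n} ξ n i`. -/
def genSize {Ω : Type*} (ξ : ℕ → ℕ → Ω → ℕ) : ℕ → Ω → ℕ
  | 0, _ => 1
  | n + 1, ω => ∑ i ∈ Finset.range (genSize ξ n ω), ξ n i ω

/-- The mean offspring number `a = E N`, where `N` has law `ν`. -/
noncomputable def meanOffspring (ν : Measure ℕ) : ℝ := ∫ n, (n : ℝ) ∂ν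

/-- The minimal offspring number `μ = min {n : P(N = n) > 0}`, where `N` has law `ν`. -/
noncomputable def minOffspring (ν : Measure ℕ) : ℕ := sInf {n : ℕ | 0 < ν {n}}

/-- The martingale limit `W = lim Z_n / a ^ n`. -/
noncomputable def martingaleLimit {Ω : Type*} (ν : Measure ℕ) (ξ : ℕ → ℕ → Ω → ℕ) (ω : Ω) : ℝ :=
  limUnder atTop (fun n : ℕ => (genSize ξ n ω : ℝ) / meanOffspring ν ^ n)

/-- The random time `K = min {k : Z_k > μ ^ k}`. -/
noncomputable def branchTime {Ω : Type*} (ν : Measure ℕ) (ξ : ℕ → ℕ → Ω → ℕ) (ω : Ω) : ℕ :=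
  sInf {k : ℕ | minOffspring ν ^ k < genSize ξ k ω}

/-- The threshold `γ(ε) = log (1 / ε) / log a` of the case `μ = 1`. -/
noncomputable def threshold (ν : Measure ℕ) (ε : ℝ) : ℝ :=
  Real.log (1 / ε) / Real.log (meanOffspring ν)

end GaltonWatson

/-!
The whole argument runs through the Laplace transform `L(s) = E exp (-s W)`; no decomposition of
the tree into independent subtrees is needed. Write `f` for the offspring generating function,
`a` for the mean and `p = P(N = 1)`. Given the first `k` generations, `E x ^ Z_{k+m}` is
`f^[m](x) ^ Z_k` (`setIntegral_pow_genSize_add`). With `x = exp (-s / a ^ (k+m))` and `m → ∞`, this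
says that conditionally on the first `k` generations `exp (-s W)` has mean `L(s / a ^ k) ^ Z_k`
(`setIntegral_exp_eq`, `setIntegral_exp_le`). Because `N ≥ 1`, it also gives
`p L(s) ≤ L(a s) ≤ p L(s) + (1 - p) L(s) ^ 2`.

`Z_n / a ^ n` is a nonnegative martingale, so `W` exists almost surely. By the `N log N` condition
the error made in linearising `f` at `1` is summable along the scales `a ^ (-k)`, and therefore
`L(1) < 1` (`exists_iterate_pgf_le`). The quadratic recursion then forces `L(a ^ k) ≤ C p ^ k`.
In particular `W > 0`, so the line of first individuals must branch at some time, as otherwise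
`Z_n / a ^ n = a ^ (-n)`.

Up to null sets `K = k + 1` is the event that `ξ j 0 = 1` for `j < k` and `ξ k 0 ≥ 2`. Let
`q < γ(ε) ≤ q + 1`.
* `P(W < ε) ≤ e L(a ^ q)` is at most of order `p ^ q`.
* `P(W < ε, K = q + 1)` is at least of order `p ^ q`: conditionally on `Z_{q+1} = n`, the
  probability of `a ^ (q+1) W < 1` is at least `L(σ) ^ n - exp (-σ)`, which is positive for a
  suitable `σ` as `L` decays only polynomially (`exists_le_measureReal_branchesAt`).
* `P(K > q + r) = p ^ (q + r)`, and `P(W < ε, K = q + 1 - i)` is at most of order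
  `p ^ (q - i) L(a ^ (i - 1)) ^ 2`, that is `p ^ (q + i)`, for the first branching leaves two
  independent lines which both have to be small (`measureReal_early_le`).

So the conditional probability of a deviation by `x ≥ 1` is both bounded away from `1` and
`O(p ^ x)`, uniformly in `ε < 1`, which yields `exp (-lam x)` for a small `lam`.
-/

namespace GaltonWatson

/-! ### The offspring generating function -/

/-- The probability generating function `x ↦ E x ^ N`, where `N` has law `ν`. -/
noncomputable def pgf (ν : Measure ℕ) (x : ℝ) : ℝ := ∫ n, x ^ n ∂ν

/-- The quantity `E [N min(1, N y)]`, which controls how far `1 - pgf ν (1 - y)` lies below its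
linear approximation `a y`. -/
noncomputable def linearDefect (ν : Measure ℕ) (y : ℝ) : ℝ := ∫ n, (n : ℝ) * min 1 (n * y) ∂ν

section Offspring

variable {ν : Measure ℕ} [IsProbabilityMeasure ν]

lemma integrable_const_pow {x : ℝ} (hx0 : 0 ≤ x) (hx1 : x ≤ 1) :
    Integrable (fun n : ℕ => x ^ n) ν := by
  refine Integrable.of_bound (measurable_of_countable _).aestronglyMeasurable 1
    (Eventually.of_forall fun n => ?_)
  rw [Real.norm_of_nonneg (pow_nonneg hx0 n)]
  exact pow_le_one₀ hx0 hx1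

omit [IsProbabilityMeasure ν] in
lemma pgf_nonneg {x : ℝ} (hx0 : 0 ≤ x) : 0 ≤ pgf ν x :=
  integral_nonneg fun n => pow_nonneg hx0 n

lemma pgf_le_one {x : ℝ} (hx0 : 0 ≤ x) (hx1 : x ≤ 1) : pgf ν x ≤ 1 := by
  calc pgf ν x ≤ ∫ _, (1 : ℝ) ∂ν :=
        integral_mono (integrable_const_pow hx0 hx1) (integrable_const _)
          fun n => pow_le_one₀ hx0 hx1
    _ = 1 := by simp

lemma iterate_pgf_mem {x : ℝ} (hx0 : 0 ≤ x) (hx1 : x ≤ 1) (n : ℕ) :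
    0 ≤ (pgf ν)^[n] x ∧ (pgf ν)^[n] x ≤ 1 := by
  induction n with
  | zero => exact ⟨hx0, hx1⟩
  | succ n ih =>
    rw [Function.iterate_succ_apply']
    exact ⟨pgf_nonneg ih.1, pgf_le_one ih.1 ih.2⟩

omit [IsProbabilityMeasure ν] in
lemma integral_indicator_singleton_mul (m : ℕ) (c : ℝ) :
    ∫ n, ({m} : Set ℕ).indicator (fun _ => c) n ∂ν = ν.real {m} * c := by
  rw [integral_indicator_const _ (measurableSet_singleton m), smul_eq_mul]

lemma mul_le_pgf {x : ℝ} (hx0 : 0 ≤ x) (hx1 : x ≤ 1) : ν.real {1} * x ≤ pgf ν x := by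
  rw [← integral_indicator_singleton_mul]
  refine integral_mono ((integrable_const x).indicator (measurableSet_singleton 1))
    (integrable_const_pow hx0 hx1) fun n => ?_
  by_cases hn : n = 1
  · simp [hn]
  · simp [hn, pow_nonneg hx0]

/-- Without mass at `0`, at most the mass at `1` contributes linearly to the generating function. -/
lemma pgf_le (hν_zero : ν {0} = 0) {x : ℝ} (hx0 : 0 ≤ x) (hx1 : x ≤ 1) :
    pgf ν x ≤ ν.real {1} * x + (1 - ν.real {1}) * x ^ 2 := by
  have h0 : ∀ᵐ n ∂ν, n ≠ 0 := by
    rw [ae_iff]; simpa using hν_zero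
  have hi : Integrable (({1} : Set ℕ).indicator (fun _ => x - x ^ 2)) ν :=
    (integrable_const _).indicator (measurableSet_singleton 1)
  calc pgf ν x ≤ ∫ n, (({1} : Set ℕ).indicator (fun _ => x - x ^ 2) n + x ^ 2) ∂ν := by
        refine integral_mono_ae (integrable_const_pow hx0 hx1) (hi.add (integrable_const _)) ?_
        filter_upwards [h0] with n hn
        by_cases h1 : n = 1
        · simp [h1]
        · have : 2 ≤ n := by omega
          simpa [h1] using pow_le_pow_of_le_one hx0 hx1 this
    _ = ν.real {1} * x + (1 - ν.real {1}) * x ^ 2 := by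
        rw [integral_add hi (integrable_const _), integral_indicator_singleton_mul]
        simp; ring

lemma integrable_id_of_log (hν_log : Integrable (fun n : ℕ => (n : ℝ) * Real.log n) ν) :
    Integrable (fun n : ℕ => (n : ℝ)) ν := by
  refine (hν_log.add (integrable_const (2 : ℝ))).mono'
    (measurable_of_countable _).aestronglyMeasurable (Eventually.of_forall fun n => ?_)
  rw [Real.norm_of_nonneg (Nat.cast_nonneg n)]
  simp only [Pi.add_apply]
  by_cases hn : n ≤ 2
  · have h1 : (n : ℝ) ≤ 2 := by exact_mod_cast hn
    have := mul_nonneg (Nat.cast_nonneg (α := ℝ) n) (Real.log_natCast_nonneg n)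
    linarith
  · have h3 : (3 : ℝ) ≤ n := by exact_mod_cast (by omega : 3 ≤ n)
    have h1 : 1 ≤ Real.log n := by
      rw [Real.le_log_iff_exp_le (by linarith)]
      exact (Real.exp_one_lt_d9.le.trans (by norm_num)).trans h3
    nlinarith

lemma exists_two_le_measure_pos (hν_zero : ν {0} = 0) (hν_nondeg : ∀ k : ℕ, ν ≠ Measure.dirac k) :
    ∃ m, 2 ≤ m ∧ 0 < ν.real {m} := by
  by_contra! h
  have h1 : ∀ᵐ n ∂ν, n = 1 := by
    rw [ae_iff_of_countable]
    intro n hn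
    by_contra hn1
    rcases Nat.lt_or_ge n 2 with h2 | h2
    · obtain rfl : n = 0 := by omega
      exact hn hν_zero
    · have := h n h2
      have h3 : ν.real {n} = 0 := le_antisymm this measureReal_nonneg
      rw [measureReal_eq_zero_iff] at h3
      exact hn h3
  refine hν_nondeg 1 ?_
  have h2 : (id : ℕ → ℕ) =ᵐ[ν] fun _ => 1 := h1
  simpa using Measure.map_congr h2

lemma measureReal_one_lt_one (hν_zero : ν {0} = 0) (hν_nondeg : ∀ k : ℕ, ν ≠ Measure.dirac k) :
    ν.real {1} < 1 := by
  obtain ⟨m, hm, hpos⟩ := exists_two_le_measure_pos hν_zero hν_nondeg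
  have h := measureReal_union (μ := ν) (s₁ := {1}) (s₂ := {m})
    (by simp; omega) (measurableSet_singleton m)
  have h2 : ν.real ({1} ∪ {m}) ≤ 1 := measureReal_le_one
  linarith

lemma one_lt_meanOffspring (hν_zero : ν {0} = 0) (hν_nondeg : ∀ k : ℕ, ν ≠ Measure.dirac k)
    (hint : Integrable (fun n : ℕ => (n : ℝ)) ν) : 1 < meanOffspring ν := by
  obtain ⟨m, hm, hpos⟩ := exists_two_le_measure_pos hν_zero hν_nondeg
  have h0 : ∀ᵐ n ∂ν, n ≠ 0 := by
    rw [ae_iff]; simpa using hν_zero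
  have hi : Integrable (({m} : Set ℕ).indicator (fun _ => (1 : ℝ))) ν :=
    (integrable_const _).indicator (measurableSet_singleton m)
  have : ∫ n, (({m} : Set ℕ).indicator (fun _ => (1 : ℝ)) n + 1) ∂ν ≤ meanOffspring ν := by
    refine integral_mono_ae (hi.add (integrable_const _)) hint ?_
    filter_upwards [h0] with n hn
    by_cases h1 : n = m
    · have : (2 : ℝ) ≤ m := by exact_mod_cast hm
      simp [h1]; linarith
    · have : (1 : ℝ) ≤ n := by exact_mod_cast Nat.one_le_iff_ne_zero.2 hn
      simpa [h1] using this
  rw [integral_add hi (integrable_const _), integral_indicator_singleton_mul] at this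
  simp at this
  linarith

lemma measureReal_one_pos (hν_min : minOffspring ν = 1) : 0 < ν.real {1} := by
  have hne : {n : ℕ | 0 < ν {n}}.Nonempty := by
    by_contra h
    rw [Set.not_nonempty_iff_eq_empty] at h
    simp [minOffspring, h] at hν_min
  have := Nat.sInf_mem hne
  change sInf {n : ℕ | 0 < ν {n}} = 1 at hν_min
  rw [hν_min] at this
  exact ENNReal.toReal_pos (ne_of_gt this) (measure_ne_top _ _)

/-! ### Non-degeneracy of the limit under the `N log N` condition -/

omit [IsProbabilityMeasure ν] in
lemma integrable_linearDefect (hint : Integrable (fun n : ℕ => (n : ℝ)) ν) {y : ℝ} (hy : 0 ≤ y) :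
    Integrable (fun n : ℕ => (n : ℝ) * min 1 (n * y)) ν := by
  refine hint.mono' (measurable_of_countable _).aestronglyMeasurable
    (Eventually.of_forall fun n => ?_)
  have h : 0 ≤ min 1 ((n : ℝ) * y) := by positivity
  rw [Real.norm_of_nonneg (mul_nonneg (Nat.cast_nonneg n) h)]
  exact mul_le_of_le_one_right (Nat.cast_nonneg n) (min_le_left _ _)

omit [IsProbabilityMeasure ν] in
lemma linearDefect_nonneg {y : ℝ} (hy : 0 ≤ y) : 0 ≤ linearDefect ν y :=
  integral_nonneg fun n => by positivity

omit [IsProbabilityMeasure ν] in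
lemma linearDefect_mono (hint : Integrable (fun n : ℕ => (n : ℝ)) ν) {y z : ℝ} (hy : 0 ≤ y)
    (hyz : y ≤ z) : linearDefect ν y ≤ linearDefect ν z :=
  integral_mono (integrable_linearDefect hint hy) (integrable_linearDefect hint (hy.trans hyz))
    fun n => by dsimp only; gcongr

lemma one_sub_pgf_le (hint : Integrable (fun n : ℕ => (n : ℝ)) ν) {y : ℝ} (hy0 : 0 ≤ y)
    (hy1 : y ≤ 1) : 1 - pgf ν (1 - y) ≤ meanOffspring ν * y := by
  have h : ∫ n : ℕ, (1 - (n : ℝ) * y) ∂ν ≤ pgf ν (1 - y) :=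
    integral_mono ((integrable_const _).sub (hint.mul_const y))
      (integrable_const_pow (by linarith) (by linarith)) fun n => by
        have := one_add_mul_le_pow (a := -y) (by linarith) n
        simpa [sub_eq_add_neg] using this
  rw [integral_sub (integrable_const _) (hint.mul_const y), integral_mul_const] at h
  simp only [integral_const, probReal_univ, smul_eq_mul, mul_one] at h
  unfold meanOffspring
  linarith

lemma le_one_sub_pgf (hint : Integrable (fun n : ℕ => (n : ℝ)) ν) {y : ℝ} (hy0 : 0 ≤ y)
    (hy1 : y ≤ 1) :
    meanOffspring ν * y - y * linearDefect ν y ≤ 1 - pgf ν (1 - y) := by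
  have hd := integrable_linearDefect hint hy0
  have h : pgf ν (1 - y) ≤ ∫ n : ℕ, (1 - (n : ℝ) * y + y * ((n : ℝ) * min 1 (n * y))) ∂ν := by
    refine integral_mono (integrable_const_pow (by linarith) (by linarith))
      (((integrable_const _).sub (hint.mul_const y)).add (hd.const_mul y)) fun n => ?_
    rcases le_total ((n : ℝ) * y) 1 with h1 | h1
    · have h2 : (1 - y) ^ n ≤ Real.exp (-(n * y)) := by
        calc (1 - y) ^ n ≤ Real.exp (-y) ^ n :=
              pow_le_pow_left₀ (by linarith) (Real.one_sub_le_exp_neg y) n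
          _ = Real.exp (-(n * y)) := by rw [← Real.exp_nat_mul]; ring_nf
      have hny : 0 ≤ (n : ℝ) * y := by positivity
      have h3 := Real.abs_exp_sub_one_sub_id_le (x := -(n * y))
        (by rwa [abs_neg, abs_of_nonneg hny])
      have h4 := (abs_le.1 h3).2
      simp only [min_eq_right h1]
      nlinarith
    · have h2 : (1 - y) ^ n ≤ 1 := pow_le_one₀ (by linarith) (by linarith)
      simp only [min_eq_left h1]
      linarith
  have hsub : Integrable (fun n : ℕ => 1 - (n : ℝ) * y) ν :=
    (integrable_const _).sub (hint.mul_const y)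
  rw [integral_add hsub (hd.const_mul y), integral_sub (integrable_const _) (hint.mul_const y),
    integral_mul_const, integral_const_mul] at h
  simp only [integral_const, probReal_univ, smul_eq_mul, mul_one] at h
  unfold meanOffspring linearDefect
  linarith

/-- The logarithm of `N` counts the scales `a ^ (-k)` which are coarser than `1 / N`. -/
lemma sum_min_le {a : ℝ} (ha : 1 < a) (n K : ℕ) :
    ∑ k ∈ Finset.range K, min 1 ((n : ℝ) * a⁻¹ ^ k) ≤
      Real.log n / Real.log a + (1 + (1 - a⁻¹)⁻¹) := by
  have hla : 0 < Real.log a := Real.log_pos ha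
  have ha0 : 0 < a := by linarith
  have hia : a⁻¹ < 1 := inv_lt_one_of_one_lt₀ ha
  have hia0 : 0 < a⁻¹ := inv_pos.2 ha0
  -- The first `m` terms are bounded by `1`, the others by a geometric series, as `n ≤ a ^ m`.
  set m := ⌈Real.log n / Real.log a⌉₊ with hm
  have hlog : 0 ≤ Real.log n / Real.log a := div_nonneg (Real.log_natCast_nonneg n) hla.le
  have hm1 : (m : ℝ) ≤ Real.log n / Real.log a + 1 := (Nat.ceil_lt_add_one hlog).le
  have hnm : (n : ℝ) ≤ a ^ m := by
    rcases Nat.eq_zero_or_pos n with rfl | hn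
    · simp; positivity
    · have hn' : (0 : ℝ) < n := by exact_mod_cast hn
      rw [← Real.log_le_log_iff hn' (by positivity), Real.log_pow, ← div_le_iff₀ hla]
      exact Nat.le_ceil _
  have hgeo : Summable (fun k : ℕ => a⁻¹ ^ k) := summable_geometric_of_lt_one hia0.le hia
  have h1 : ∑ k ∈ Finset.range K, min 1 ((n : ℝ) * a⁻¹ ^ k) ≤
      ∑ k ∈ Finset.range (m + K), min 1 ((n : ℝ) * a⁻¹ ^ k) :=
    Finset.sum_le_sum_of_subset_of_nonneg (Finset.range_mono (by omega))
      fun i _ _ => by positivity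
  have h2 : ∑ k ∈ Finset.range m, min 1 ((n : ℝ) * a⁻¹ ^ k) ≤ m := by
    calc _ ≤ ∑ k ∈ Finset.range m, (1 : ℝ) := Finset.sum_le_sum fun i _ => min_le_left _ _
      _ = m := by simp
  have h3 : ∑ k ∈ Finset.range K, min 1 ((n : ℝ) * a⁻¹ ^ (m + k)) ≤ (1 - a⁻¹)⁻¹ := by
    rw [← tsum_geometric_of_lt_one hia0.le hia]
    refine le_trans (Finset.sum_le_sum fun k _ => ?_)
      (hgeo.sum_le_tsum (Finset.range K) fun i _ => by positivity)
    refine (min_le_right _ _).trans ?_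
    rw [pow_add, ← mul_assoc]
    refine mul_le_of_le_one_left (by positivity) ?_
    rw [inv_pow, ← div_eq_mul_inv]
    exact div_le_one_of_le₀ hnm (by positivity)
  rw [Finset.sum_range_add] at h1
  linarith

lemma summable_linearDefect (hν_log : Integrable (fun n : ℕ => (n : ℝ) * Real.log n) ν) {a : ℝ}
    (ha : 1 < a) : Summable (fun k : ℕ => linearDefect ν (a⁻¹ ^ k)) := by
  have hint := integrable_id_of_log hν_log
  have ha0 : 0 < a⁻¹ := inv_pos.2 (by linarith)
  refine summable_of_sum_range_le
    (c := ∫ n : ℕ, ((n : ℝ) * Real.log n * (Real.log a)⁻¹ + n * (1 + (1 - a⁻¹)⁻¹)) ∂ν)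
    (fun k => linearDefect_nonneg (by positivity)) fun K => ?_
  unfold linearDefect
  rw [← integral_finsetSum _ fun k _ => integrable_linearDefect hint (by positivity)]
  refine integral_mono
    (integrable_finsetSum _ fun k _ => integrable_linearDefect hint (by positivity))
    ((hν_log.mul_const _).add (hint.mul_const _)) fun n => ?_
  dsimp only
  rw [← Finset.mul_sum]
  refine (mul_le_mul_of_nonneg_left (sum_min_le ha n K) (Nat.cast_nonneg n)).trans (le_of_eq ?_)
  rw [div_eq_mul_inv]; ring

/-- Quantitative linearisation of the iterates of the generating function near its fixed
point `1`. -/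
lemma one_sub_iterate_pgf (hint : Integrable (fun n : ℕ => (n : ℝ)) ν) (ha : 1 < meanOffspring ν)
    {y : ℝ} (hy0 : 0 ≤ y) (hy1 : y ≤ 1) (j : ℕ) :
    1 - (pgf ν)^[j] (1 - y) ≤ meanOffspring ν ^ j * y ∧
      meanOffspring ν ^ j * y *
        (1 - (meanOffspring ν)⁻¹ *
          ∑ i ∈ Finset.range j, linearDefect ν (meanOffspring ν ^ i * y)) ≤
        1 - (pgf ν)^[j] (1 - y) := by
  set a := meanOffspring ν with ha_def
  have ha0 : 0 < a := by linarith
  induction j with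
  | zero => simp
  | succ j ih =>
    obtain ⟨ih1, ih2⟩ := ih
    have hmem := iterate_pgf_mem (ν := ν) (x := 1 - y) (by linarith) (by linarith) j
    rw [Function.iterate_succ_apply']
    set u := 1 - (pgf ν)^[j] (1 - y) with hu
    have hu' : (pgf ν)^[j] (1 - y) = 1 - u := by rw [hu]; ring
    rw [hu'] at hmem ⊢
    have hu0 : 0 ≤ u := by linarith
    have hu1 : u ≤ 1 := by linarith
    have hup := one_sub_pgf_le hint hu0 hu1
    have hlo := le_one_sub_pgf hint hu0 hu1
    rw [← ha_def] at hup hlo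
    refine ⟨hup.trans ?_, le_trans ?_ hlo⟩
    · rw [pow_succ', mul_assoc]; gcongr
    · have hD : u * linearDefect ν u ≤ a ^ j * y * linearDefect ν (a ^ j * y) :=
        mul_le_mul ih1 (linearDefect_mono hint hu0 ih1) (linearDefect_nonneg hu0) (by positivity)
      have h2 := mul_le_mul_of_nonneg_left ih2 ha0.le
      rw [Finset.sum_range_succ, pow_succ']
      have : a * a ^ j * y * (1 - a⁻¹ * (∑ i ∈ Finset.range j, linearDefect ν (a ^ i * y) +
            linearDefect ν (a ^ j * y))) =
          a * (a ^ j * y * (1 - a⁻¹ * ∑ i ∈ Finset.range j, linearDefect ν (a ^ i * y))) -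
            a ^ j * y * linearDefect ν (a ^ j * y) := by
        field_simp; ring
      rw [this]
      linarith

/-- The analytic core of the Kesten–Stigum theorem: under the `N log N` condition, the Laplace
transforms of the normalised generation sizes stay away from `1` at some fixed argument. -/
lemma exists_iterate_pgf_le (hν_log : Integrable (fun n : ℕ => (n : ℝ) * Real.log n) ν)
    (ha : 1 < meanOffspring ν) :
    ∃ s : ℝ, 0 < s ∧ s ≤ 1 ∧ ∃ c : ℝ, 0 < c ∧
      ∀ n : ℕ, (pgf ν)^[n] (Real.exp (-s / meanOffspring ν ^ n)) ≤ 1 - c := by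
  have hint := integrable_id_of_log hν_log
  set a := meanOffspring ν with ha_def
  have ha0 : 0 < a := by linarith
  have hsum := summable_linearDefect hν_log ha
  have htail := tendsto_sum_nat_add (fun k : ℕ => linearDefect ν (a⁻¹ ^ k))
  -- `s = a ^ (-m)`, with `m` so large that the defects at all finer scales add up to at most
  -- half of the mean.
  obtain ⟨m, hm⟩ := ((tendsto_add_atTop_iff_nat 1).2 htail).eventually_le_const
    (show (0 : ℝ) < a / 2 by positivity) |>.exists
  have hs1 : a⁻¹ ^ m ≤ 1 := pow_le_one₀ (by positivity) (inv_le_one_of_one_le₀ ha.le)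
  refine ⟨a⁻¹ ^ m, by positivity, hs1, a⁻¹ ^ m / 4, by positivity, fun n => ?_⟩
  set s := a⁻¹ ^ m with hs
  have hs0 : 0 < s := by positivity
  set t := s / a ^ n with ht
  have ht0 : 0 < t := by positivity
  have ht1 : t ≤ 1 := (div_le_self hs0.le (one_le_pow₀ ha.le)).trans hs1
  set y := 1 - Real.exp (-t) with hy
  have hyt : y ≤ t := by have := Real.one_sub_le_exp_neg t; linarith
  have hty : t / 2 ≤ y := by
    have h1 : Real.exp (-t) ≤ (1 + t)⁻¹ := by
      rw [Real.exp_neg]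
      exact inv_anti₀ (by positivity) (by linarith [Real.add_one_le_exp t])
    have h2 : (1 + t)⁻¹ ≤ 1 - t / 2 := by
      rw [inv_le_iff_one_le_mul₀ (by positivity)]; nlinarith
    linarith
  have hy0 : 0 ≤ y := by linarith
  have hmain := (one_sub_iterate_pgf hint ha hy0 (hyt.trans ht1) n).2
  rw [← ha_def] at hmain
  have hS : ∑ i ∈ Finset.range n, linearDefect ν (a ^ i * y) ≤ a / 2 := by
    rw [← Finset.sum_range_reflect]
    refine le_trans (Finset.sum_le_sum (g := fun k => linearDefect ν (a⁻¹ ^ (k + (m + 1))))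
      fun k hk => ?_) (le_trans (((summable_nat_add_iff (m + 1)).2 hsum).sum_le_tsum _ fun i _ =>
        linearDefect_nonneg (by positivity)) hm)
    refine linearDefect_mono hint (by positivity) ?_
    have hk' := Finset.mem_range.1 hk
    calc a ^ (n - 1 - k) * y ≤ a ^ (n - 1 - k) * t := by gcongr
      _ = a⁻¹ ^ (k + (m + 1)) := by
        have hn : a ^ n = a ^ (n - 1 - k) * a ^ (k + 1) := by
          rw [← pow_add]; congr 1; omega
        rw [ht, hs, hn]
        simp only [inv_pow, pow_add]
        field_simp
  have hS' : (1 : ℝ) / 2 ≤ 1 - a⁻¹ * ∑ i ∈ Finset.range n, linearDefect ν (a ^ i * y) := by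
    have := mul_le_mul_of_nonneg_left hS (inv_nonneg.2 ha0.le)
    have h2 : a⁻¹ * (a / 2) = 1 / 2 := by field_simp
    linarith
  have hay : s / 2 ≤ a ^ n * y := by
    have : a ^ n * (t / 2) = s / 2 := by rw [ht]; field_simp
    rw [← this]; gcongr
  have : s / 2 * (1 / 2) ≤ 1 - (pgf ν)^[n] (1 - y) :=
    le_trans (mul_le_mul hay hS' (by norm_num) (by positivity)) hmain
  have hexp : Real.exp (-s / a ^ n) = 1 - y := by rw [hy, ht, neg_div]; ring
  rw [hexp]
  linarith

end Offspring

/-- A sequence started below `1` and satisfying `l (k + 1) ≤ p l k + (1 - p) (l k) ^ 2` decays like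
`p ^ k`: it decays geometrically at some rate, so the quadratic terms only contribute a
convergent product. -/
lemma exists_le_mul_pow_of_quadratic {p : ℝ} (hp0 : 0 < p) (hp1 : p < 1) {l : ℕ → ℝ}
    (hl0 : ∀ k, 0 ≤ l k) (hl1 : l 0 < 1)
    (hl : ∀ k, l (k + 1) ≤ p * l k + (1 - p) * l k ^ 2) :
    ∃ C : ℝ, 0 < C ∧ ∀ k, l k ≤ C * p ^ k := by
  set r := p + (1 - p) * l 0 with hr
  have hr0 : 0 < r := by have := mul_nonneg (sub_nonneg.2 hp1.le) (hl0 0); linarith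
  have hr1 : r < 1 := by nlinarith
  have hgeo : ∀ k, l k ≤ l 0 * r ^ k := by
    intro k
    induction k with
    | zero => simp
    | succ k ih =>
      have h1 : l k ≤ l 0 :=
        ih.trans (mul_le_of_le_one_right (hl0 0) (pow_le_one₀ hr0.le hr1.le))
      calc l (k + 1) ≤ p * l k + (1 - p) * l k ^ 2 := hl k
        _ ≤ l k * r := by
          have h2 := mul_le_mul_of_nonneg_left h1 (mul_nonneg (sub_nonneg.2 hp1.le) (hl0 k))
          rw [hr]; linarith
        _ ≤ l 0 * r ^ k * r := by gcongr
        _ = l 0 * r ^ (k + 1) := by ring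
  have hexp : ∀ k, l k ≤ Real.exp (p⁻¹ * ∑ i ∈ Finset.range k, r ^ i) * p ^ k := by
    intro k
    induction k with
    | zero => simpa using hl1.le
    | succ k ih =>
      have h1 : l k ≤ r ^ k := (hgeo k).trans (mul_le_of_le_one_left (by positivity) hl1.le)
      calc l (k + 1) ≤ p * l k * (1 + p⁻¹ * l k) := by
            have h2 : p * l k * (1 + p⁻¹ * l k) = p * l k + l k ^ 2 := by field_simp
            nlinarith [hl k, sq_nonneg (l k)]
        _ ≤ p * (Real.exp (p⁻¹ * ∑ i ∈ Finset.range k, r ^ i) * p ^ k) *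
              Real.exp (p⁻¹ * r ^ k) := by
            have h3 : 1 + p⁻¹ * l k ≤ Real.exp (p⁻¹ * r ^ k) := by
              have := Real.add_one_le_exp (p⁻¹ * r ^ k)
              have h4 : p⁻¹ * l k ≤ p⁻¹ * r ^ k := by gcongr
              linarith
            have := mul_nonneg (inv_nonneg.2 hp0.le) (hl0 k)
            gcongr
        _ = _ := by
            rw [Finset.sum_range_succ, mul_add, Real.exp_add]; ring
  refine ⟨Real.exp (p⁻¹ * (1 - r)⁻¹), Real.exp_pos _, fun k => (hexp k).trans ?_⟩
  gcongr
  rw [← tsum_geometric_of_lt_one hr0.le hr1]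
  exact (summable_geometric_of_lt_one hr0.le hr1).sum_le_tsum _ fun i _ => by positivity

open scoped ENNReal

/-! ### The branching step -/

/-- The standing assumptions: the `ξ n i` are independent with law `ν`, which has no mass at `0`,
is not a point mass, satisfies the `N log N` condition and charges `1`. -/
structure IsBranching {Ω : Type*} [MeasurableSpace Ω] (P : Measure Ω) (ν : Measure ℕ)
    (ξ : ℕ → ℕ → Ω → ℕ) : Prop where
  meas : ∀ n i, Measurable (ξ n i)
  law : ∀ n i, P.map (ξ n i) = ν
  indep : iIndepFun (fun q : ℕ × ℕ => ξ q.1 q.2) P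
  zero : ν {0} = 0
  nondeg : ∀ k : ℕ, ν ≠ Measure.dirac k
  log : Integrable (fun n : ℕ => (n : ℝ) * Real.log n) ν
  min_eq : minOffspring ν = 1

/-- The σ-algebra generated by the offspring numbers in the generations belonging to `S`. -/
@[reducible]
def generationsAlgebra {Ω : Type*} (ξ : ℕ → ℕ → Ω → ℕ) (S : Set ℕ) : MeasurableSpace Ω :=
  ⨆ q ∈ {q : ℕ × ℕ | q.1 ∈ S}, MeasurableSpace.comap (ξ q.1 q.2) inferInstance

lemma measurable_generationsAlgebra {Ω : Type*} {ξ : ℕ → ℕ → Ω → ℕ} {S : Set ℕ} {n : ℕ}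
    (hn : n ∈ S) (i : ℕ) : Measurable[generationsAlgebra ξ S] (ξ n i) := by
  rw [measurable_iff_comap_le]
  exact le_iSup₂_of_le (f := fun (q : ℕ × ℕ) (_ : q ∈ {q : ℕ × ℕ | q.1 ∈ S}) =>
    MeasurableSpace.comap (ξ q.1 q.2) inferInstance) (n, i) hn le_rfl

/-- The history of the process: `n ↦ σ(ξ m i, m < n)`. -/
def history {Ω : Type*} [mΩ : MeasurableSpace Ω] {ξ : ℕ → ℕ → Ω → ℕ}
    (hξ : ∀ n i, Measurable (ξ n i)) : Filtration ℕ mΩ where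
  seq n := generationsAlgebra ξ (Set.Iio n)
  mono' _ _ hmn := biSup_mono fun _ hq => lt_of_lt_of_le hq hmn
  le' _ := iSup₂_le fun q _ => (hξ q.1 q.2).comap_le

lemma measurable_sum_range {Ω : Type*} [MeasurableSpace Ω] {Z : Ω → ℕ} {X : ℕ → Ω → ℕ}
    (hZ : Measurable Z) (hX : ∀ i, Measurable (X i)) :
    Measurable fun ω => ∑ i ∈ Finset.range (Z ω), X i ω := by
  have h : Measurable fun q : ℕ × Ω => ∑ i ∈ Finset.range q.1, X i q.2 :=
    measurable_from_prod_countable_right fun k =>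
      Finset.measurable_sum (Finset.range k) fun i _ => hX i
  exact h.comp (hZ.prodMk measurable_id)

namespace IsBranching

variable {Ω : Type*} [MeasurableSpace Ω] {P : Measure Ω} [IsProbabilityMeasure P]
  {ν : Measure ℕ} [IsProbabilityMeasure ν] {ξ : ℕ → ℕ → Ω → ℕ}

omit [IsProbabilityMeasure P] in
lemma integrable_id (h : IsBranching P ν ξ) : Integrable (fun n : ℕ => (n : ℝ)) ν :=
  integrable_id_of_log h.log

omit [IsProbabilityMeasure P] in
lemma one_lt_mean (h : IsBranching P ν ξ) : 1 < meanOffspring ν :=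
  one_lt_meanOffspring h.zero h.nondeg h.integrable_id

omit [IsProbabilityMeasure P] in
lemma mean_pos (h : IsBranching P ν ξ) : 0 < meanOffspring ν := one_pos.trans h.one_lt_mean

omit [IsProbabilityMeasure P] [IsProbabilityMeasure ν] in
lemma measurable_genSize_history (h : IsBranching P ν ξ) (n : ℕ) :
    Measurable[history h.meas n] (genSize ξ n) := by
  induction n with
  | zero => exact measurable_const
  | succ n ih =>
    exact @measurable_sum_range Ω (history h.meas (n + 1)) _ _
      (ih.mono ((history h.meas).mono n.le_succ) le_rfl)
      fun i => measurable_generationsAlgebra (S := Set.Iio (n + 1)) (Set.mem_Iio.2 n.lt_succ_self) i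

omit [IsProbabilityMeasure P] [IsProbabilityMeasure ν] in
lemma measurable_genSize (h : IsBranching P ν ξ) (n : ℕ) : Measurable (genSize ξ n) :=
  (h.measurable_genSize_history n).mono ((history h.meas).le n) le_rfl

omit [IsProbabilityMeasure P] [IsProbabilityMeasure ν] in
lemma indep_history (h : IsBranching P ν ξ) (n : ℕ) :
    Indep (generationsAlgebra ξ {n}) (history h.meas n) P := by
  refine indep_iSup_of_disjoint
    (m := fun q : ℕ × ℕ => MeasurableSpace.comap (ξ q.1 q.2) inferInstance)
    (S := {q | q.1 ∈ ({n} : Set ℕ)}) (T := {q | q.1 ∈ Set.Iio n})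
    (fun q => (h.meas q.1 q.2).comap_le)
    ((iIndepFun_iff_iIndep _ _ _).1 h.indep) ?_
  rw [Set.disjoint_left]
  rintro q hq hq'
  have h1 : q.1 = n := hq
  have h2 : q.1 < n := hq'
  omega

omit [IsProbabilityMeasure P] [IsProbabilityMeasure ν] in
/-- Given the past, a functional of the offspring numbers of generation `n` may be averaged after
fixing the size of that generation. -/
lemma setLIntegral_genSize (h : IsBranching P ν ξ) {n : ℕ} {A : Set Ω}
    (hA : MeasurableSet[history h.meas n] A) {Y : ℕ → Ω → ℝ≥0∞} {c : ℕ → ℝ≥0∞}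
    (hY : ∀ k, Measurable[generationsAlgebra ξ {n}] (Y k)) (hc : ∀ k, ∫⁻ ω, Y k ω ∂P = c k) :
    ∫⁻ ω in A, Y (genSize ξ n ω) ω ∂P = ∫⁻ ω in A, c (genSize ξ n ω) ∂P := by
  have hrow : generationsAlgebra ξ {n} ≤ ‹MeasurableSpace Ω› :=
    iSup₂_le fun q _ => (h.meas q.1 q.2).comap_le
  have hBm : ∀ k, MeasurableSet[history h.meas n] (A ∩ genSize ξ n ⁻¹' {k}) := fun k =>
    hA.inter (h.measurable_genSize_history n (measurableSet_singleton k))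
  have hBm' : ∀ k, MeasurableSet (A ∩ genSize ξ n ⁻¹' {k}) := fun k =>
    (history h.meas).le n _ (hBm k)
  have hU : A = ⋃ k, A ∩ genSize ξ n ⁻¹' {k} := by
    ext ω; simp
  have hd : Pairwise (Function.onFun Disjoint fun k => A ∩ genSize ξ n ⁻¹' {k}) := by
    intro i j hij
    rw [Function.onFun, Set.disjoint_left]
    rintro ω ⟨_, hi⟩ ⟨_, hj⟩
    exact hij (hi.symm.trans hj)
  rw [hU, lintegral_iUnion hBm' hd, lintegral_iUnion hBm' hd]
  refine tsum_congr fun k => ?_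
  have e1 : ∫⁻ ω in A ∩ genSize ξ n ⁻¹' {k}, Y (genSize ξ n ω) ω ∂P =
      ∫⁻ ω in A ∩ genSize ξ n ⁻¹' {k}, Y k ω ∂P :=
    setLIntegral_congr_fun (hBm' k) fun ω hω => by
      have : genSize ξ n ω = k := hω.2
      simp only [this]
  have e2 : ∫⁻ ω in A ∩ genSize ξ n ⁻¹' {k}, c (genSize ξ n ω) ∂P =
      ∫⁻ _ in A ∩ genSize ξ n ⁻¹' {k}, c k ∂P :=
    setLIntegral_congr_fun (hBm' k) fun ω hω => by
      have : genSize ξ n ω = k := hω.2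
      simp only [this]
  rw [e1, e2, setLIntegral_const, ← hc k, ← lintegral_indicator (hBm' k)]
  have e3 := lintegral_mul_eq_lintegral_mul_lintegral_of_independent_measurableSpace hrow
    ((history h.meas).le n) (h.indep_history n) (hY k)
    (measurable_const.indicator (hBm k) : Measurable[history h.meas n]
      ((A ∩ genSize ξ n ⁻¹' {k}).indicator fun _ => (1 : ℝ≥0∞)))
  rw [lintegral_indicator_const (hBm' k), one_mul] at e3
  rw [← e3]
  refine lintegral_congr fun ω => ?_
  by_cases hω : ω ∈ A ∩ genSize ξ n ⁻¹' {k}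
  · simp only [Set.indicator_of_mem hω, mul_one]
  · simp only [Set.indicator_of_notMem hω, mul_zero]

omit [IsProbabilityMeasure P] in
lemma lintegral_prod_pow (h : IsBranching P ν ξ) (n k : ℕ) {x : ℝ} (hx0 : 0 ≤ x) (hx1 : x ≤ 1) :
    ∫⁻ ω, ∏ i ∈ Finset.range k, ENNReal.ofReal (x ^ ξ n i ω) ∂P =
      ENNReal.ofReal (pgf ν x ^ k) := by
  have hm : Measurable fun m : ℕ => ENNReal.ofReal (x ^ m) := measurable_of_countable _
  have hind : iIndepFun (fun i => ξ n i) P :=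
    h.indep.precomp (g := fun i : ℕ => (n, i)) fun i j hij => congrArg Prod.snd hij
  have hind' := hind.comp (fun _ m => ENNReal.ofReal (x ^ m)) fun _ => hm
  have hprod := lintegral_prod_eq_prod_lintegral_of_indepFun (Finset.range k) _ hind'
    fun i => hm.comp (h.meas n i)
  simp only [Function.comp_apply] at hprod
  rw [hprod]
  have hi : ∀ i, ∫⁻ ω, ENNReal.ofReal (x ^ ξ n i ω) ∂P = ENNReal.ofReal (pgf ν x) := fun i => by
    rw [← lintegral_map hm (h.meas n i), h.law n i, pgf,
      ofReal_integral_eq_lintegral_ofReal (integrable_const_pow hx0 hx1)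
        (Eventually.of_forall fun m => pow_nonneg hx0 m)]
  simp only [hi, Finset.prod_const, Finset.card_range]
  rw [ENNReal.ofReal_pow (pgf_nonneg hx0)]

omit [IsProbabilityMeasure P] in
lemma setIntegral_pow_genSize_succ (h : IsBranching P ν ξ) {n : ℕ} {A : Set Ω}
    (hA : MeasurableSet[history h.meas n] A) {x : ℝ} (hx0 : 0 ≤ x) (hx1 : x ≤ 1) :
    ∫ ω in A, x ^ genSize ξ (n + 1) ω ∂P = ∫ ω in A, pgf ν x ^ genSize ξ n ω ∂P := by
  have hmeas : ∀ (y : ℝ) (k : ℕ), Measurable fun ω => y ^ genSize ξ k ω := fun y k =>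
    (measurable_of_countable fun m : ℕ => y ^ m).comp (h.measurable_genSize k)
  rw [integral_eq_lintegral_of_nonneg_ae (Eventually.of_forall fun ω => pow_nonneg hx0 _)
      (hmeas _ _).aestronglyMeasurable,
    integral_eq_lintegral_of_nonneg_ae
      (Eventually.of_forall fun ω => pow_nonneg (pgf_nonneg hx0) _)
      (hmeas _ _).aestronglyMeasurable]
  congr 1
  rw [← h.setLIntegral_genSize hA
    (Y := fun k ω => ∏ i ∈ Finset.range k, ENNReal.ofReal (x ^ ξ n i ω))
    (c := fun k => ENNReal.ofReal (pgf ν x ^ k)) (fun k => ?_)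
    fun k => h.lintegral_prod_pow n k hx0 hx1]
  · refine lintegral_congr fun ω => ?_
    rw [← ENNReal.ofReal_prod_of_nonneg fun i _ => pow_nonneg hx0 _, Finset.prod_pow_eq_pow_sum]
    rfl
  · exact Finset.measurable_prod _ fun i _ =>
      (measurable_of_countable fun m : ℕ => ENNReal.ofReal (x ^ m)).comp
        (measurable_generationsAlgebra (Set.mem_singleton n) i)

omit [IsProbabilityMeasure P] in
lemma setIntegral_pow_genSize_add (h : IsBranching P ν ξ) {k : ℕ} {A : Set Ω}
    (hA : MeasurableSet[history h.meas k] A) (m : ℕ) {x : ℝ} (hx0 : 0 ≤ x) (hx1 : x ≤ 1) :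
    ∫ ω in A, x ^ genSize ξ (k + m) ω ∂P = ∫ ω in A, (pgf ν)^[m] x ^ genSize ξ k ω ∂P := by
  induction m generalizing x with
  | zero => rfl
  | succ m ih =>
    rw [Function.iterate_succ_apply, ← ih (pgf_nonneg hx0) (pgf_le_one hx0 hx1), ← add_assoc,
      h.setIntegral_pow_genSize_succ ((history h.meas).mono (Nat.le_add_right k m) _ hA) hx0 hx1]

/-! ### The martingale limit and its Laplace transform -/

omit [IsProbabilityMeasure P] in
lemma setLIntegral_genSize_succ (h : IsBranching P ν ξ) {n : ℕ} {A : Set Ω}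
    (hA : MeasurableSet[history h.meas n] A) :
    ∫⁻ ω in A, (genSize ξ (n + 1) ω : ℝ≥0∞) ∂P =
      ENNReal.ofReal (meanOffspring ν) * ∫⁻ ω in A, (genSize ξ n ω : ℝ≥0∞) ∂P := by
  have hm : Measurable fun m : ℕ => (m : ℝ≥0∞) := measurable_of_countable _
  have hi : ∀ i, ∫⁻ ω, (ξ n i ω : ℝ≥0∞) ∂P = ENNReal.ofReal (meanOffspring ν) := fun i => by
    rw [← lintegral_map hm (h.meas n i), h.law n i, meanOffspring,
      ofReal_integral_eq_lintegral_ofReal h.integrable_id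
        (Eventually.of_forall fun m => Nat.cast_nonneg m)]
    simp
  have hm' : Measurable fun ω => (genSize ξ n ω : ℝ≥0∞) := hm.comp (h.measurable_genSize n)
  rw [← lintegral_const_mul _ hm']
  have := h.setLIntegral_genSize hA
    (Y := fun k ω => ∑ i ∈ Finset.range k, (ξ n i ω : ℝ≥0∞))
    (c := fun k => ENNReal.ofReal (meanOffspring ν) * k)
    (fun k => Finset.measurable_sum _ fun i _ =>
      hm.comp (measurable_generationsAlgebra (Set.mem_singleton n) i))
    (fun k => by
      have hm2 : ∀ i, Measurable fun ω => (ξ n i ω : ℝ≥0∞) := fun i => hm.comp (h.meas n i)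
      rw [lintegral_finsetSum _ fun i _ => hm2 i]
      simp [hi, mul_comm])
  rw [← this]
  refine lintegral_congr fun ω => ?_
  rw [← Nat.cast_sum]
  rfl

lemma lintegral_genSize (h : IsBranching P ν ξ) (n : ℕ) :
    ∫⁻ ω, (genSize ξ n ω : ℝ≥0∞) ∂P = ENNReal.ofReal (meanOffspring ν) ^ n := by
  induction n with
  | zero => simp [genSize]
  | succ n ih =>
    have := h.setLIntegral_genSize_succ (n := n) MeasurableSet.univ
    simp only [Measure.restrict_univ] at this
    rw [this, ih, pow_succ']

lemma integrable_genSize (h : IsBranching P ν ξ) (n : ℕ) :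
    Integrable (fun ω => (genSize ξ n ω : ℝ)) P := by
  refine ⟨((measurable_of_countable _).comp (h.measurable_genSize n)).aestronglyMeasurable, ?_⟩
  rw [hasFiniteIntegral_iff_ofReal (Eventually.of_forall fun ω => Nat.cast_nonneg _)]
  simp only [ENNReal.ofReal_natCast, h.lintegral_genSize]
  exact ENNReal.pow_lt_top ENNReal.ofReal_lt_top

lemma setIntegral_genSize_succ (h : IsBranching P ν ξ) {n : ℕ} {A : Set Ω}
    (hA : MeasurableSet[history h.meas n] A) :
    ∫ ω in A, (genSize ξ (n + 1) ω : ℝ) ∂P =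
      meanOffspring ν * ∫ ω in A, (genSize ξ n ω : ℝ) ∂P := by
  rw [integral_eq_lintegral_of_nonneg_ae (Eventually.of_forall fun ω => Nat.cast_nonneg _)
      (h.integrable_genSize _).aestronglyMeasurable.restrict,
    integral_eq_lintegral_of_nonneg_ae (Eventually.of_forall fun ω => Nat.cast_nonneg _)
      (h.integrable_genSize _).aestronglyMeasurable.restrict]
  simp only [ENNReal.ofReal_natCast]
  rw [h.setLIntegral_genSize_succ hA, ENNReal.toReal_mul, ENNReal.toReal_ofReal h.mean_pos.le]

lemma martingale_genSize_div (h : IsBranching P ν ξ) :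
    Martingale (fun n ω => (genSize ξ n ω : ℝ) / meanOffspring ν ^ n) (history h.meas) P := by
  refine martingale_of_setIntegral_eq_succ (fun n => ?_)
    (fun n => (h.integrable_genSize n).div_const _) fun n A hA => ?_
  · exact (((measurable_of_countable fun m : ℕ => (m : ℝ) / meanOffspring ν ^ n)).comp
      (h.measurable_genSize_history n)).stronglyMeasurable
  · have := h.mean_pos
    rw [integral_div, integral_div, h.setIntegral_genSize_succ hA, pow_succ']
    field_simp

lemma ae_tendsto_martingaleLimit (h : IsBranching P ν ξ) :
    ∀ᵐ ω ∂P, Tendsto (fun n : ℕ => (genSize ξ n ω : ℝ) / meanOffspring ν ^ n) atTop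
      (𝓝 (martingaleLimit ν ξ ω)) := by
  have hbdd : ∀ n, eLpNorm (fun ω => (genSize ξ n ω : ℝ) / meanOffspring ν ^ n) 1 P ≤
      ((1 : NNReal) : ℝ≥0∞) := fun n => by
    have ha := h.mean_pos
    have hnorm : ∀ ω, ‖(genSize ξ n ω : ℝ) / meanOffspring ν ^ n‖ₑ =
        (ENNReal.ofReal (meanOffspring ν) ^ n)⁻¹ * (genSize ξ n ω : ℝ≥0∞) := fun ω => by
      rw [Real.enorm_of_nonneg (by positivity), ENNReal.ofReal_div_of_pos (by positivity),
        ENNReal.ofReal_natCast, ENNReal.ofReal_pow ha.le, div_eq_mul_inv, mul_comm]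
    rw [eLpNorm_one_eq_lintegral_enorm]
    have hm : Measurable fun ω => (genSize ξ n ω : ℝ≥0∞) :=
      (measurable_of_countable fun m : ℕ => (m : ℝ≥0∞)).comp (h.measurable_genSize n)
    simp only [hnorm]
    rw [lintegral_const_mul _ hm, h.lintegral_genSize, ENNReal.inv_mul_cancel]
    · simp
    · exact pow_ne_zero _ (by simpa using ha)
    · exact ENNReal.pow_ne_top ENNReal.ofReal_ne_top
  filter_upwards [h.martingale_genSize_div.submartingale.exists_ae_tendsto_of_bdd hbdd] with ω hω
  exact tendsto_nhds_limUnder hω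

omit [IsProbabilityMeasure P] [IsProbabilityMeasure ν] in
lemma measurable_martingaleLimit (h : IsBranching P ν ξ) : Measurable (martingaleLimit ν ξ) :=
  (StronglyMeasurable.limUnder fun n =>
    (((measurable_of_countable fun m : ℕ => (m : ℝ) / meanOffspring ν ^ n)).comp
      (h.measurable_genSize n)).stronglyMeasurable).measurable

lemma ae_martingaleLimit_nonneg (h : IsBranching P ν ξ) :
    ∀ᵐ ω ∂P, 0 ≤ martingaleLimit ν ξ ω := by
  have ha := h.mean_pos
  filter_upwards [h.ae_tendsto_martingaleLimit] with ω hω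
  exact ge_of_tendsto' hω fun n => by positivity

end IsBranching

/-- The Laplace transform `s ↦ E exp (-s W)` of the martingale limit. -/
noncomputable def laplace {Ω : Type*} [MeasurableSpace Ω] (P : Measure Ω) (ν : Measure ℕ)
    (ξ : ℕ → ℕ → Ω → ℕ) (s : ℝ) : ℝ := ∫ ω, Real.exp (-s * martingaleLimit ν ξ ω) ∂P

namespace IsBranching

variable {Ω : Type*} [MeasurableSpace Ω] {P : Measure Ω} [IsProbabilityMeasure P]
  {ν : Measure ℕ} [IsProbabilityMeasure ν] {ξ : ℕ → ℕ → Ω → ℕ}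

lemma integrable_exp (h : IsBranching P ν ξ) {s : ℝ} (hs : 0 ≤ s) :
    Integrable (fun ω => Real.exp (-s * martingaleLimit ν ξ ω)) P := by
  refine Integrable.of_bound
    ((h.measurable_martingaleLimit.const_mul _).exp).aestronglyMeasurable 1 ?_
  filter_upwards [h.ae_martingaleLimit_nonneg] with ω hω
  rw [Real.norm_of_nonneg (Real.exp_pos _).le, Real.exp_le_one_iff]
  nlinarith

lemma tendsto_setIntegral_exp (h : IsBranching P ν ξ) {s : ℝ} (hs : 0 ≤ s) (A : Set Ω) :
    Tendsto (fun n : ℕ => ∫ ω in A, Real.exp (-s / meanOffspring ν ^ n) ^ genSize ξ n ω ∂P) atTop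
      (𝓝 (∫ ω in A, Real.exp (-s * martingaleLimit ν ξ ω) ∂P)) := by
  have ha := h.mean_pos
  refine tendsto_integral_of_dominated_convergence (fun _ => 1) (fun n => ?_)
    (integrable_const _) (fun n => Eventually.of_forall fun ω => ?_) (ae_restrict_of_ae ?_)
  · exact ((measurable_of_countable fun m : ℕ =>
      Real.exp (-s / meanOffspring ν ^ n) ^ m).comp (h.measurable_genSize n)).aestronglyMeasurable
  · rw [Real.norm_of_nonneg (by positivity)]
    refine pow_le_one₀ (Real.exp_pos _).le (Real.exp_le_one_iff.2 ?_)
    exact div_nonpos_of_nonpos_of_nonneg (by linarith) (by positivity)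
  · filter_upwards [h.ae_tendsto_martingaleLimit] with ω hω
    have := (Real.continuous_exp.tendsto _).comp (hω.const_mul (-s))
    refine this.congr fun n => ?_
    rw [Function.comp_apply, ← Real.exp_nat_mul]
    congr 1
    ring

omit [IsProbabilityMeasure P] in
lemma exp_mem (h : IsBranching P ν ξ) {s : ℝ} (hs : 0 ≤ s) (n : ℕ) :
    0 ≤ Real.exp (-s / meanOffspring ν ^ n) ∧ Real.exp (-s / meanOffspring ν ^ n) ≤ 1 := by
  have ha := h.mean_pos
  refine ⟨(Real.exp_pos _).le, Real.exp_le_one_iff.2 ?_⟩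
  exact div_nonpos_of_nonpos_of_nonneg (by linarith) (by positivity)

lemma tendsto_iterate_pgf (h : IsBranching P ν ξ) {s : ℝ} (hs : 0 ≤ s) :
    Tendsto (fun n : ℕ => (pgf ν)^[n] (Real.exp (-s / meanOffspring ν ^ n))) atTop
      (𝓝 (laplace P ν ξ s)) := by
  have := h.tendsto_setIntegral_exp hs Set.univ
  simp only [Measure.restrict_univ] at this
  refine this.congr fun n => ?_
  have h2 := h.setIntegral_pow_genSize_add (k := 0) MeasurableSet.univ n (h.exp_mem hs n).1
    (h.exp_mem hs n).2
  simpa [genSize] using h2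

/-- The branching property of the Laplace transform before passing to the limit: the iterates
converge to `laplace P ν ξ (s / a ^ k)`, so that, given the first `k` generations, `exp (-s W)` has
mean `laplace P ν ξ (s / a ^ k) ^ Z_k`. -/
lemma tendsto_setIntegral_iterate_pgf (h : IsBranching P ν ξ) {s : ℝ} (hs : 0 ≤ s) {k : ℕ}
    {A : Set Ω} (hA : MeasurableSet[history h.meas k] A) :
    Tendsto (fun m : ℕ => ∫ ω in A,
      (pgf ν)^[m] (Real.exp (-(s / meanOffspring ν ^ k) / meanOffspring ν ^ m)) ^ genSize ξ k ω ∂P)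
      atTop (𝓝 (∫ ω in A, Real.exp (-s * martingaleLimit ν ξ ω) ∂P)) := by
  have h1 := (tendsto_add_atTop_iff_nat k).2 (h.tendsto_setIntegral_exp hs A)
  refine h1.congr fun m => ?_
  rw [add_comm m k, h.setIntegral_pow_genSize_add hA m (h.exp_mem hs _).1 (h.exp_mem hs _).2]
  have : -s / meanOffspring ν ^ (k + m) = -(s / meanOffspring ν ^ k) / meanOffspring ν ^ m := by
    rw [pow_add, ← neg_div, div_div]
  rw [this]

lemma setIntegral_exp_eq (h : IsBranching P ν ξ) {s : ℝ} (hs : 0 ≤ s) {k n : ℕ} {A : Set Ω}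
    (hA : MeasurableSet[history h.meas k] A) (hZ : ∀ ω ∈ A, genSize ξ k ω = n) :
    ∫ ω in A, Real.exp (-s * martingaleLimit ν ξ ω) ∂P =
      P.real A * laplace P ν ξ (s / meanOffspring ν ^ k) ^ n := by
  have ha := h.mean_pos
  refine tendsto_nhds_unique (h.tendsto_setIntegral_iterate_pgf hs hA) ?_
  refine (((h.tendsto_iterate_pgf (s := s / meanOffspring ν ^ k) (by positivity)).pow n).const_mul
    (P.real A)).congr fun m => ?_
  rw [setIntegral_congr_fun ((history h.meas).le k _ hA) (g := fun _ =>
    (pgf ν)^[m] (Real.exp (-(s / meanOffspring ν ^ k) / meanOffspring ν ^ m)) ^ n)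
    fun ω hω => by simp only [hZ ω hω], setIntegral_const, smul_eq_mul]

lemma setIntegral_exp_le (h : IsBranching P ν ξ) {s : ℝ} (hs : 0 ≤ s) {k n : ℕ} {A : Set Ω}
    (hA : MeasurableSet[history h.meas k] A) (hZ : ∀ ω ∈ A, n ≤ genSize ξ k ω) :
    ∫ ω in A, Real.exp (-s * martingaleLimit ν ξ ω) ∂P ≤
      P.real A * laplace P ν ξ (s / meanOffspring ν ^ k) ^ n := by
  have ha := h.mean_pos
  have hs' : 0 ≤ s / meanOffspring ν ^ k := by positivity
  refine le_of_tendsto_of_tendsto' (h.tendsto_setIntegral_iterate_pgf hs hA)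
    (((h.tendsto_iterate_pgf hs').pow n).const_mul (P.real A)) fun m => ?_
  obtain ⟨h0, h1⟩ := iterate_pgf_mem (ν := ν) (h.exp_mem hs' m).1 (h.exp_mem hs' m).2 m
  have hAm := (history h.meas).le k _ hA
  have hint : Integrable (fun ω =>
      (pgf ν)^[m] (Real.exp (-(s / meanOffspring ν ^ k) / meanOffspring ν ^ m)) ^ genSize ξ k ω)
      P := by
    refine Integrable.of_bound ((measurable_of_countable fun j : ℕ => (pgf ν)^[m]
      (Real.exp (-(s / meanOffspring ν ^ k) / meanOffspring ν ^ m)) ^ j).comp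
      (h.measurable_genSize k)).aestronglyMeasurable 1 (Eventually.of_forall fun ω => ?_)
    rw [Real.norm_of_nonneg (pow_nonneg h0 _)]
    exact pow_le_one₀ h0 h1
  refine (setIntegral_mono_on hint.integrableOn (integrable_const _).integrableOn hAm
    fun ω hω => pow_le_pow_of_le_one h0 h1 (hZ ω hω)).trans (le_of_eq ?_)
  rw [setIntegral_const, smul_eq_mul]

lemma laplace_pos (h : IsBranching P ν ξ) {s : ℝ} (hs : 0 ≤ s) : 0 < laplace P ν ξ s :=
  integral_exp_pos (h.integrable_exp hs)

lemma laplace_anti (h : IsBranching P ν ξ) {s t : ℝ} (hs : 0 ≤ s) (hst : s ≤ t) :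
    laplace P ν ξ t ≤ laplace P ν ξ s := by
  refine integral_mono_ae (h.integrable_exp (hs.trans hst)) (h.integrable_exp hs) ?_
  filter_upwards [h.ae_martingaleLimit_nonneg] with ω hω
  exact Real.exp_le_exp.2 (by nlinarith)

lemma tendsto_pgf_iterate_pgf (h : IsBranching P ν ξ) {s : ℝ} (hs : 0 ≤ s) :
    Tendsto (fun n : ℕ => pgf ν ((pgf ν)^[n] (Real.exp (-s / meanOffspring ν ^ n)))) atTop
      (𝓝 (laplace P ν ξ (meanOffspring ν * s))) := by
  have ha := h.mean_pos
  refine ((tendsto_add_atTop_iff_nat 1).2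
    (h.tendsto_iterate_pgf (s := meanOffspring ν * s) (by positivity))).congr fun n => ?_
  rw [Function.iterate_succ_apply']
  have : -(meanOffspring ν * s) / meanOffspring ν ^ (n + 1) = -s / meanOffspring ν ^ n := by
    rw [pow_succ']; field_simp
  rw [this]

lemma laplace_mul_le (h : IsBranching P ν ξ) {s : ℝ} (hs : 0 ≤ s) :
    laplace P ν ξ (meanOffspring ν * s) ≤
      ν.real {1} * laplace P ν ξ s + (1 - ν.real {1}) * laplace P ν ξ s ^ 2 := by
  have ht := h.tendsto_iterate_pgf hs
  refine le_of_tendsto_of_tendsto' (h.tendsto_pgf_iterate_pgf hs)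
    ((ht.const_mul _).add ((ht.pow 2).const_mul _)) fun n => ?_
  obtain ⟨h0, h1⟩ := iterate_pgf_mem (ν := ν) (h.exp_mem hs n).1 (h.exp_mem hs n).2 n
  exact pgf_le h.zero h0 h1

lemma mul_laplace_le (h : IsBranching P ν ξ) {s : ℝ} (hs : 0 ≤ s) :
    ν.real {1} * laplace P ν ξ s ≤ laplace P ν ξ (meanOffspring ν * s) := by
  refine le_of_tendsto_of_tendsto' ((h.tendsto_iterate_pgf hs).const_mul _)
    (h.tendsto_pgf_iterate_pgf hs) fun n => ?_
  obtain ⟨h0, h1⟩ := iterate_pgf_mem (ν := ν) (h.exp_mem hs n).1 (h.exp_mem hs n).2 n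
  exact mul_le_pgf h0 h1

lemma laplace_one_lt_one (h : IsBranching P ν ξ) : laplace P ν ξ 1 < 1 := by
  obtain ⟨s, hs0, hs1, c, hc, hle⟩ := exists_iterate_pgf_le h.log h.one_lt_mean
  have h1 := le_of_tendsto' (h.tendsto_iterate_pgf hs0.le) hle
  have h2 := h.laplace_anti hs0.le hs1
  linarith

omit [IsProbabilityMeasure P] in
lemma mass_one_mem (h : IsBranching P ν ξ) : 0 < ν.real {1} ∧ ν.real {1} < 1 :=
  ⟨measureReal_one_pos h.min_eq, measureReal_one_lt_one h.zero h.nondeg⟩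

lemma exists_laplace_pow_le (h : IsBranching P ν ξ) :
    ∃ C : ℝ, 0 < C ∧ ∀ k : ℕ, laplace P ν ξ (meanOffspring ν ^ k) ≤ C * ν.real {1} ^ k := by
  have ha := h.mean_pos
  refine exists_le_mul_pow_of_quadratic h.mass_one_mem.1 h.mass_one_mem.2
    (l := fun k => laplace P ν ξ (meanOffspring ν ^ k))
    (fun k => (h.laplace_pos (by positivity)).le) (by simpa using h.laplace_one_lt_one) fun k => ?_
  simp only [pow_succ' _ k]
  exact h.laplace_mul_le (by positivity)

lemma le_laplace_pow (h : IsBranching P ν ξ) (k : ℕ) :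
    ν.real {1} ^ k * laplace P ν ξ 1 ≤ laplace P ν ξ (meanOffspring ν ^ k) := by
  have ha := h.mean_pos
  induction k with
  | zero => simp
  | succ k ih =>
    rw [pow_succ', pow_succ', mul_assoc]
    exact (mul_le_mul_of_nonneg_left ih h.mass_one_mem.1.le).trans
      (h.mul_laplace_le (by positivity))

/-- The Laplace transform decays polynomially, hence its powers eventually beat `exp (-s)`. -/
lemma exists_exp_neg_lt_laplace_pow (h : IsBranching P ν ξ) (n : ℕ) :
    ∃ σ : ℝ, 0 < σ ∧ Real.exp (-σ) < laplace P ν ξ σ ^ n := by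
  have ha := h.mean_pos
  set a := meanOffspring ν
  set p := ν.real {1} with hp
  have hp0 : 0 < p := h.mass_one_mem.1
  have hl0 : 0 < laplace P ν ξ 1 := h.laplace_pos zero_le_one
  have hia : a⁻¹ < 1 := inv_lt_one_of_one_lt₀ h.one_lt_mean
  have hia0 : 0 ≤ a⁻¹ := by positivity
  have t1 := (tendsto_pow_atTop_nhds_zero_of_lt_one hia0 hia).const_mul
    (n * -Real.log (laplace P ν ξ 1))
  have t2 := (tendsto_self_mul_const_pow_of_lt_one hia0 hia).const_mul (n * -Real.log p)
  have t3 := t1.add t2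
  simp only [mul_zero, add_zero] at t3
  obtain ⟨j, hj⟩ := (t3.eventually_lt_const one_pos).exists
  refine ⟨a ^ j, by positivity, ?_⟩
  have haj : 0 < a ^ j := by positivity
  have e : Real.exp (-a ^ j) < (p ^ j * laplace P ν ξ 1) ^ n := by
    rw [← Real.lt_log_iff_exp_lt (by positivity), Real.log_pow,
      Real.log_mul (by positivity) hl0.ne', Real.log_pow]
    rw [inv_pow] at hj
    have h3 := mul_lt_mul_of_pos_right hj haj
    have h4 : (n * -Real.log (laplace P ν ξ 1) * (a ^ j)⁻¹ +
        n * -Real.log p * (j * (a ^ j)⁻¹)) * a ^ j =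
        n * -Real.log (laplace P ν ξ 1) + n * -Real.log p * j := by
      field_simp
    rw [h4] at h3
    linarith
  exact e.trans_le (pow_le_pow_left₀ (by positivity) (h.le_laplace_pow j) n)

/-- Markov's inequality for `exp (-s W)`, which is at least `1 / e` where `W < ε ≤ 1 / s`. -/
lemma measureReal_lt_inter_le (h : IsBranching P ν ξ) {s ε : ℝ} (hs : 0 ≤ s) (hε : s * ε ≤ 1)
    {A : Set Ω} (hA : MeasurableSet A) :
    P.real ({ω | martingaleLimit ν ξ ω < ε} ∩ A) ≤
      Real.exp 1 * ∫ ω in A, Real.exp (-s * martingaleLimit ν ξ ω) ∂P := by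
  have hS : MeasurableSet {ω | martingaleLimit ν ξ ω < ε} :=
    measurableSet_lt h.measurable_martingaleLimit measurable_const
  have hi := (h.integrable_exp hs).integrableOn (s := {ω | martingaleLimit ν ξ ω < ε} ∩ A)
  calc P.real ({ω | martingaleLimit ν ξ ω < ε} ∩ A)
      = ∫ ω in {ω | martingaleLimit ν ξ ω < ε} ∩ A, (1 : ℝ) ∂P := by
        rw [setIntegral_const, smul_eq_mul, mul_one]
    _ ≤ ∫ ω in {ω | martingaleLimit ν ξ ω < ε} ∩ A,
          Real.exp 1 * Real.exp (-s * martingaleLimit ν ξ ω) ∂P := by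
        refine setIntegral_mono_on (integrable_const _).integrableOn (hi.const_mul _)
          (hS.inter hA) fun ω hω => ?_
        rw [← Real.exp_add, Real.one_le_exp_iff]
        have h1 : martingaleLimit ν ξ ω < ε := hω.1
        nlinarith
    _ = Real.exp 1 * ∫ ω in {ω | martingaleLimit ν ξ ω < ε} ∩ A,
          Real.exp (-s * martingaleLimit ν ξ ω) ∂P := integral_const_mul _ _
    _ ≤ _ := by
        refine mul_le_mul_of_nonneg_left (setIntegral_mono_set
          (h.integrable_exp hs).integrableOn (Eventually.of_forall fun ω => (Real.exp_pos _).le)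
          (Eventually.of_forall fun ω hω => hω.2)) (Real.exp_pos _).le

lemma measureReal_lt_le (h : IsBranching P ν ξ) {s ε : ℝ} (hs : 0 ≤ s) (hε : s * ε ≤ 1) :
    P.real {ω | martingaleLimit ν ξ ω < ε} ≤ Real.exp 1 * laplace P ν ξ s := by
  simpa [laplace] using h.measureReal_lt_inter_le hs hε MeasurableSet.univ

lemma ae_martingaleLimit_pos (h : IsBranching P ν ξ) : ∀ᵐ ω ∂P, 0 < martingaleLimit ν ξ ω := by
  have ha := h.mean_pos
  obtain ⟨C, hC, hle⟩ := h.exists_laplace_pow_le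
  have h0 : P.real {ω | martingaleLimit ν ξ ω ≤ 0} ≤ 0 := by
    have ht := ((tendsto_pow_atTop_nhds_zero_of_lt_one h.mass_one_mem.1.le
      h.mass_one_mem.2).const_mul C).const_mul (Real.exp 1)
    simp only [mul_zero] at ht
    refine ge_of_tendsto' ht fun k => ?_
    have hk : 0 < meanOffspring ν ^ k := by positivity
    calc P.real {ω | martingaleLimit ν ξ ω ≤ 0}
        ≤ P.real {ω | martingaleLimit ν ξ ω < (meanOffspring ν ^ k)⁻¹} :=
          measureReal_mono fun ω hω => lt_of_le_of_lt hω (inv_pos.2 hk)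
      _ ≤ _ := (h.measureReal_lt_le hk.le (mul_inv_cancel₀ hk.ne').le).trans
          (mul_le_mul_of_nonneg_left (hle k) (Real.exp_pos _).le)
  have h1 := le_antisymm h0 measureReal_nonneg
  rw [measureReal_eq_zero_iff] at h1
  rw [ae_iff]
  simpa using h1

/-- If the population never exceeded `1`, `Z_n / a ^ n` would tend to `0`. -/
lemma ae_exists_branching (h : IsBranching P ν ξ) : ∀ᵐ ω ∂P, ∃ k, 1 < genSize ξ k ω := by
  have ha := h.mean_pos
  filter_upwards [h.ae_tendsto_martingaleLimit, h.ae_martingaleLimit_pos] with ω hω hpos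
  by_contra! hle
  have ht := tendsto_pow_atTop_nhds_zero_of_lt_one (inv_nonneg.2 ha.le)
    (inv_lt_one_of_one_lt₀ h.one_lt_mean)
  refine hpos.not_ge (le_of_tendsto_of_tendsto' hω ht fun n => ?_)
  rw [inv_pow, ← one_div]
  gcongr
  exact_mod_cast hle n

end IsBranching

/-! ### The branching time -/

/-- The event that the first individual of each of the generations `0, …, k - 1` has exactly one
child. By induction the generations `0, …, k` then consist of a single individual. -/
def unbranchedUntil {Ω : Type*} (ξ : ℕ → ℕ → Ω → ℕ) (k : ℕ) : Set Ω := {ω | ∀ j < k, ξ j 0 ω = 1}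

/-- The event that the single line branches for the first time in generation `k`, so that the
branching time is `k + 1`. -/
def branchesAt {Ω : Type*} (ξ : ℕ → ℕ → Ω → ℕ) (k : ℕ) : Set Ω :=
  unbranchedUntil ξ k ∩ {ω | 2 ≤ ξ k 0 ω}

lemma genSize_eq_one {Ω : Type*} {ξ : ℕ → ℕ → Ω → ℕ} {k : ℕ} {ω : Ω}
    (hω : ω ∈ unbranchedUntil ξ k) {j : ℕ} (hj : j ≤ k) : genSize ξ j ω = 1 := by
  induction j with
  | zero => rfl
  | succ j ih =>
    rw [genSize, ih (by omega)]
    simpa using hω j (by omega)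

lemma genSize_succ_eq {Ω : Type*} {ξ : ℕ → ℕ → Ω → ℕ} {k : ℕ} {ω : Ω}
    (hω : ω ∈ unbranchedUntil ξ k) : genSize ξ (k + 1) ω = ξ k 0 ω := by
  rw [genSize, genSize_eq_one hω le_rfl]
  simp

lemma unbranchedUntil_anti {Ω : Type*} (ξ : ℕ → ℕ → Ω → ℕ) {j k : ℕ} (hjk : j ≤ k) :
    unbranchedUntil ξ k ⊆ unbranchedUntil ξ j := fun _ hω i hi => hω i (hi.trans_le hjk)

lemma unbranchedUntil_succ {Ω : Type*} (ξ : ℕ → ℕ → Ω → ℕ) (k : ℕ) :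
    unbranchedUntil ξ (k + 1) = unbranchedUntil ξ k ∩ ξ k 0 ⁻¹' {1} := by
  ext ω
  exact Nat.forall_lt_succ_right

lemma exists_mem_branchesAt {Ω : Type*} {ξ : ℕ → ℕ → Ω → ℕ} {ω : Ω}
    (hpos : ∀ n i, ξ n i ω ≠ 0) (hex : ∃ k, 1 < genSize ξ k ω) :
    ∃ k, ω ∈ branchesAt ξ k := by
  by_contra! hno
  have hall : ∀ k, ω ∈ unbranchedUntil ξ k := by
    intro k
    induction k with
    | zero => intro j hj; omega
    | succ k ih =>
      rw [unbranchedUntil_succ]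
      refine ⟨ih, ?_⟩
      have h1 : ¬ 2 ≤ ξ k 0 ω := fun h2 => hno k ⟨ih, h2⟩
      have h2 := hpos k 0
      change ξ k 0 ω = 1
      omega
  obtain ⟨k, hk⟩ := hex
  rw [genSize_eq_one (hall k) le_rfl] at hk
  exact lt_irrefl _ hk

namespace IsBranching

variable {Ω : Type*} [MeasurableSpace Ω] {P : Measure Ω} {ν : Measure ℕ} {ξ : ℕ → ℕ → Ω → ℕ}

lemma branchTime_eq (h : IsBranching P ν ξ) {k : ℕ} {ω : Ω} (hω : ω ∈ branchesAt ξ k) :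
    branchTime ν ξ ω = k + 1 := by
  have hmem : k + 1 ∈ {k : ℕ | minOffspring ν ^ k < genSize ξ k ω} := by
    have := genSize_succ_eq hω.1
    have h2 : 2 ≤ ξ k 0 ω := hω.2
    simp only [Set.mem_ofPred_eq, h.min_eq, one_pow]
    omega
  refine le_antisymm (Nat.sInf_le hmem) ?_
  by_contra! hlt
  have h1 := Nat.sInf_mem ⟨_, hmem⟩
  change minOffspring ν ^ branchTime ν ξ ω < genSize ξ (branchTime ν ξ ω) ω at h1
  rw [genSize_eq_one hω.1 (by omega), h.min_eq, one_pow] at h1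
  exact lt_irrefl _ h1

lemma measurableSet_unbranchedUntil (h : IsBranching P ν ξ) (k : ℕ) :
    MeasurableSet[history h.meas k] (unbranchedUntil ξ k) := by
  have : unbranchedUntil ξ k = ⋂ j : Set.Iio k, ξ j 0 ⁻¹' {1} := by
    ext ω; simp [unbranchedUntil]
  rw [this]
  exact MeasurableSet.iInter fun j =>
    measurable_generationsAlgebra (S := Set.Iio k) j.2 0 (measurableSet_singleton 1)

lemma measurableSet_inter_offspring (h : IsBranching P ν ξ) (k : ℕ) (S : Set ℕ) :
    MeasurableSet[history h.meas (k + 1)] (unbranchedUntil ξ k ∩ ξ k 0 ⁻¹' S) :=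
  MeasurableSet.inter ((history h.meas).mono k.le_succ _ (h.measurableSet_unbranchedUntil k))
    (measurable_generationsAlgebra (S := Set.Iio (k + 1)) (Set.mem_Iio.2 k.lt_succ_self) 0
      (MeasurableSet.of_discrete))

lemma measurableSet_branchesAt (h : IsBranching P ν ξ) (k : ℕ) :
    MeasurableSet[history h.meas (k + 1)] (branchesAt ξ k) :=
  h.measurableSet_inter_offspring k (Set.Ici 2)

variable [IsProbabilityMeasure P]

omit [IsProbabilityMeasure P] in
lemma measureReal_inter_offspring (h : IsBranching P ν ξ) (k n : ℕ) :
    P.real (unbranchedUntil ξ k ∩ ξ k 0 ⁻¹' {n}) =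
      P.real (unbranchedUntil ξ k) * ν.real {n} := by
  have h1 := (Indep_iff _ _ _).1 (h.indep_history k) (ξ k 0 ⁻¹' {n}) (unbranchedUntil ξ k)
    (measurable_generationsAlgebra (Set.mem_singleton k) 0 (measurableSet_singleton n))
    (h.measurableSet_unbranchedUntil k)
  rw [← Measure.map_apply (h.meas k 0) (measurableSet_singleton n), h.law] at h1
  rw [measureReal_def, Set.inter_comm, h1, ENNReal.toReal_mul, mul_comm]
  rfl

lemma measureReal_unbranchedUntil (h : IsBranching P ν ξ) (k : ℕ) :
    P.real (unbranchedUntil ξ k) = ν.real {1} ^ k := by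
  induction k with
  | zero =>
    have : unbranchedUntil ξ 0 = Set.univ := by ext ω; simp [unbranchedUntil]
    rw [this, probReal_univ, pow_zero]
  | succ k ih => rw [unbranchedUntil_succ, h.measureReal_inter_offspring, ih, pow_succ]

omit [IsProbabilityMeasure P] in
lemma ae_offspring_ne_zero (h : IsBranching P ν ξ) : ∀ᵐ ω ∂P, ∀ n i, ξ n i ω ≠ 0 := by
  rw [ae_all_iff]; intro n
  rw [ae_all_iff]; intro i
  rw [ae_iff]
  have : {ω | ¬ ξ n i ω ≠ 0} = ξ n i ⁻¹' {0} := by ext ω; simp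
  rw [this, ← Measure.map_apply (h.meas n i) (measurableSet_singleton 0), h.law, h.zero]

variable [IsProbabilityMeasure ν]

lemma ae_exists_mem_branchesAt (h : IsBranching P ν ξ) : ∀ᵐ ω ∂P, ∃ k, ω ∈ branchesAt ξ k := by
  filter_upwards [h.ae_offspring_ne_zero, h.ae_exists_branching] with ω h1 h2
  exact exists_mem_branchesAt h1 h2

/-! ### Small values of the limit and the branching time -/

/-- A cheap strategy for `W` to be small is to postpone the first branching to a generation `q`
with `a ^ (-(q + 1)) ≤ ε`. The conditional probability that then `W < ε` is bounded
below in terms of the Laplace transform, by `L(σ) ^ n - exp (-σ)` if the branching produces `n`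
children. -/
lemma exists_le_measureReal_branchesAt (h : IsBranching P ν ξ) :
    ∃ c : ℝ, 0 < c ∧ ∀ (q : ℕ) (ε : ℝ), (meanOffspring ν ^ (q + 1))⁻¹ ≤ ε →
      c * ν.real {1} ^ q ≤ P.real ({ω | martingaleLimit ν ξ ω < ε} ∩ branchesAt ξ q) := by
  have ha := h.mean_pos
  obtain ⟨n, hn, hpos⟩ := exists_two_le_measure_pos h.zero h.nondeg
  obtain ⟨σ, hσ, hlt⟩ := h.exists_exp_neg_lt_laplace_pow n
  refine ⟨ν.real {n} * (laplace P ν ξ σ ^ n - Real.exp (-σ)), mul_pos hpos (sub_pos.2 hlt),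
    fun q ε hε => ?_⟩
  set A := unbranchedUntil ξ q ∩ ξ q 0 ⁻¹' {n} with hA_def
  set S := {ω | martingaleLimit ν ξ ω < ε} with hS_def
  have hS : MeasurableSet S := measurableSet_lt h.measurable_martingaleLimit measurable_const
  have hAh := h.measurableSet_inter_offspring q {n}
  have hA : MeasurableSet A := (history h.meas).le _ _ hAh
  have hAD : A ⊆ branchesAt ξ q := fun ω hω => ⟨hω.1, by
    have : ξ q 0 ω = n := hω.2
    change 2 ≤ ξ q 0 ω
    omega⟩
  have hPA : P.real A = ν.real {1} ^ q * ν.real {n} := by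
    rw [hA_def, h.measureReal_inter_offspring, h.measureReal_unbranchedUntil]
  have haq : 0 < meanOffspring ν ^ (q + 1) := by positivity
  have hs : 0 ≤ σ * meanOffspring ν ^ (q + 1) := by positivity
  have heq := h.setIntegral_exp_eq hs hAh (n := n) fun ω hω => by
    rw [genSize_succ_eq hω.1]; exact hω.2
  rw [mul_div_cancel_right₀ _ haq.ne', hPA] at heq
  -- On `A`, `exp (-s W) ≤ 1_{W < ε} + exp (-σ)` with `s = σ a ^ (q + 1)`.
  have hle : ∫ ω in A, Real.exp (-(σ * meanOffspring ν ^ (q + 1)) * martingaleLimit ν ξ ω) ∂P ≤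
      ∫ ω in A, (S.indicator (fun _ => (1 : ℝ)) ω + Real.exp (-σ)) ∂P := by
    refine integral_mono_ae (h.integrable_exp hs).integrableOn
      (((integrable_const _).indicator hS).add (integrable_const _)) (ae_restrict_of_ae ?_)
    filter_upwards [h.ae_martingaleLimit_nonneg] with ω hω
    by_cases hωS : ω ∈ S
    · rw [Set.indicator_of_mem hωS]
      have h1 : Real.exp (-(σ * meanOffspring ν ^ (q + 1)) * martingaleLimit ν ξ ω) ≤ 1 :=
        Real.exp_le_one_iff.2 (by nlinarith)
      have h2 := Real.exp_pos (-σ)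
      linarith
    · rw [Set.indicator_of_notMem hωS, zero_add]
      refine Real.exp_le_exp.2 ?_
      have h1 : ε ≤ martingaleLimit ν ξ ω := not_lt.1 hωS
      have h2 := mul_le_mul_of_nonneg_left (hε.trans h1) hs
      rw [mul_assoc, mul_inv_cancel₀ haq.ne', mul_one] at h2
      linarith
  rw [integral_add ((integrable_const _).indicator hS) (integrable_const _),
    integral_indicator_const _ hS, setIntegral_const, measureReal_restrict_apply hS, heq,
    hPA] at hle
  simp only [smul_eq_mul, mul_one] at hle
  have hmono : P.real (S ∩ A) ≤ P.real (S ∩ branchesAt ξ q) :=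
    measureReal_mono (Set.inter_subset_inter_right S hAD)
  nlinarith

lemma measureReal_lt_le_pow (h : IsBranching P ν ξ) {C : ℝ}
    (hC : ∀ k : ℕ, laplace P ν ξ (meanOffspring ν ^ k) ≤ C * ν.real {1} ^ k) {q : ℕ} {ε : ℝ}
    (hε : meanOffspring ν ^ q * ε ≤ 1) :
    P.real {ω | martingaleLimit ν ξ ω < ε} ≤ Real.exp 1 * C * ν.real {1} ^ q := by
  have ha := h.mean_pos
  have h1 := h.measureReal_lt_le (s := meanOffspring ν ^ q) (by positivity) hε
  have h2 := mul_le_mul_of_nonneg_left (hC q) (Real.exp_pos 1).le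
  linarith

/-- Branching into at least two independent lines, all of which have to be small, squares the
Laplace transform. -/
lemma measureReal_lt_inter_branchesAt_le (h : IsBranching P ν ξ) {C : ℝ}
    (hC : ∀ k : ℕ, laplace P ν ξ (meanOffspring ν ^ k) ≤ C * ν.real {1} ^ k) {j i : ℕ} {ε : ℝ}
    (hε : meanOffspring ν ^ (j + 1 + i) * ε ≤ 1) :
    P.real ({ω | martingaleLimit ν ξ ω < ε} ∩ branchesAt ξ j) ≤
      Real.exp 1 * C ^ 2 * ν.real {1} ^ (j + 2 * i) := by
  have ha := h.mean_pos
  have hp := h.mass_one_mem.1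
  have hs : 0 ≤ meanOffspring ν ^ (j + 1 + i) := by positivity
  have hDh := h.measurableSet_branchesAt j
  have hint := h.setIntegral_exp_le hs hDh (n := 2) fun ω hω => by
    rw [genSize_succ_eq hω.1]; exact hω.2
  have hdiv : meanOffspring ν ^ (j + 1 + i) / meanOffspring ν ^ (j + 1) = meanOffspring ν ^ i := by
    rw [pow_add]; field_simp
  rw [hdiv] at hint
  have hPD : P.real (branchesAt ξ j) ≤ ν.real {1} ^ j := by
    rw [← h.measureReal_unbranchedUntil]
    exact measureReal_mono Set.inter_subset_left
  have hsq : laplace P ν ξ (meanOffspring ν ^ i) ^ 2 ≤ (C * ν.real {1} ^ i) ^ 2 :=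
    pow_le_pow_left₀ (h.laplace_pos (by positivity)).le (hC i) 2
  calc P.real ({ω | martingaleLimit ν ξ ω < ε} ∩ branchesAt ξ j)
      ≤ Real.exp 1 * (P.real (branchesAt ξ j) * laplace P ν ξ (meanOffspring ν ^ i) ^ 2) :=
        (h.measureReal_lt_inter_le hs hε ((history h.meas).le _ _ hDh)).trans
          (mul_le_mul_of_nonneg_left hint (Real.exp_pos _).le)
    _ ≤ Real.exp 1 * (ν.real {1} ^ j * (C * ν.real {1} ^ i) ^ 2) := by gcongr
    _ = Real.exp 1 * C ^ 2 * ν.real {1} ^ (j + 2 * i) := by ring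

/-- Branching `r` or more generations too early has, jointly with `W < ε`, a probability of order
`p ^ (q + r)`. -/
lemma measureReal_early_le (h : IsBranching P ν ξ) {C : ℝ}
    (hC : ∀ k : ℕ, laplace P ν ξ (meanOffspring ν ^ k) ≤ C * ν.real {1} ^ k) {q r : ℕ} (hr : 1 ≤ r)
    {ε : ℝ} (hε : meanOffspring ν ^ q * ε ≤ 1) :
    P.real ({ω | martingaleLimit ν ξ ω < ε} ∩ ⋃ i ∈ Finset.Icc r q, branchesAt ξ (q - i)) ≤
      Real.exp 1 * C ^ 2 * (ν.real {1} ^ 2)⁻¹ * (1 - ν.real {1})⁻¹ *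
        (ν.real {1} ^ q * ν.real {1} ^ r) := by
  obtain ⟨hp0, hp1⟩ := h.mass_one_mem
  set p := ν.real {1}
  have hone : ∀ i ∈ Finset.Icc r q,
      P.real ({ω | martingaleLimit ν ξ ω < ε} ∩ branchesAt ξ (q - i)) ≤
        Real.exp 1 * C ^ 2 * (p ^ 2)⁻¹ * p ^ q * p ^ i := by
    intro i hi
    obtain ⟨h1, h2⟩ := Finset.mem_Icc.1 hi
    obtain ⟨m, rfl⟩ : ∃ m, i = m + 1 := ⟨i - 1, by omega⟩
    obtain ⟨j, rfl⟩ : ∃ j, q = j + (m + 1) := ⟨q - (m + 1), by omega⟩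
    rw [Nat.add_sub_cancel]
    refine (h.measureReal_lt_inter_branchesAt_le hC (j := j) (i := m) ?_).trans (le_of_eq ?_)
    · rwa [show j + 1 + m = j + (m + 1) by ring]
    · field_simp
      ring
  rw [Set.inter_iUnion₂]
  calc P.real (⋃ i ∈ Finset.Icc r q, {ω | martingaleLimit ν ξ ω < ε} ∩ branchesAt ξ (q - i))
      ≤ ∑ i ∈ Finset.Icc r q, Real.exp 1 * C ^ 2 * (p ^ 2)⁻¹ * p ^ q * p ^ i :=
        (measureReal_biUnion_finset_le _ _).trans (Finset.sum_le_sum hone)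
    _ = Real.exp 1 * C ^ 2 * (p ^ 2)⁻¹ * p ^ q * ∑ i ∈ Finset.Ico r (q + 1), p ^ i := by
        rw [Finset.mul_sum]; rfl
    _ ≤ Real.exp 1 * C ^ 2 * (p ^ 2)⁻¹ * p ^ q * (p ^ r * (1 - p)⁻¹) := by
        gcongr
        rw [Finset.sum_Ico_eq_sum_range, ← tsum_geometric_of_lt_one hp0.le hp1]
        simp only [pow_add, ← Finset.mul_sum]
        gcongr
        exact (summable_geometric_of_lt_one hp0.le hp1).sum_le_tsum _ fun i _ => by positivity
    _ = _ := by ring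

omit [IsProbabilityMeasure P] [IsProbabilityMeasure ν] in
/-- A deviation of the branching time from `γ ∈ (q, q + 1]` by at least `x` means that the line
branched `⌈x⌉` generations too early, or has survived `⌈x⌉ - 1` generations too long. -/
lemma mem_early_or_late (h : IsBranching P ν ξ) {q : ℕ} {γ x : ℝ} (hγ1 : q < γ) (hγ2 : γ ≤ q + 1)
    (hx : 1 ≤ x) {ω : Ω} (hω : ∃ k, ω ∈ branchesAt ξ k) (hdev : x ≤ |(branchTime ν ξ ω : ℝ) - γ|) :
    ω ∈ (⋃ i ∈ Finset.Icc ⌈x⌉₊ q, branchesAt ξ (q - i)) ∨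
      ω ∈ unbranchedUntil ξ (q + (⌈x⌉₊ - 1)) := by
  obtain ⟨k, hk⟩ := hω
  rw [h.branchTime_eq hk] at hdev
  push_cast at hdev
  have hr : 1 ≤ ⌈x⌉₊ := Nat.one_le_ceil_iff.2 (by linarith)
  rcases le_abs.1 hdev with h1 | h1
  · right
    refine unbranchedUntil_anti ξ ?_ hk.1
    have h2 : x ≤ ((k + 1 - q : ℕ) : ℝ) := by
      have h3 : q ≤ k + 1 := by
        have : (q : ℝ) ≤ (k + 1 : ℕ) := by push_cast; linarith
        exact_mod_cast this
      rw [Nat.cast_sub h3]; push_cast; linarith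
    have := Nat.ceil_le.2 h2
    omega
  · left
    have h3 : k ≤ q := by
      have : (k : ℝ) ≤ q := by linarith
      exact_mod_cast this
    have h2 : x ≤ ((q - k : ℕ) : ℝ) := by
      rw [Nat.cast_sub h3]; linarith
    have h4 := Nat.ceil_le.2 h2
    refine Set.mem_iUnion₂.2 ⟨q - k, Finset.mem_Icc.2 ⟨h4, by omega⟩, ?_⟩
    rwa [Nat.sub_sub_self h3]

end IsBranching

/-- The threshold `γ(ε)` locates `ε` on the scale of the powers of `1 / a`. -/
lemma exists_threshold_mem {ν : Measure ℕ} (ha : 1 < meanOffspring ν) {ε : ℝ} (hε0 : 0 < ε)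
    (hε1 : ε < 1) :
    ∃ q : ℕ, q < threshold ν ε ∧ threshold ν ε ≤ q + 1 ∧ meanOffspring ν ^ q * ε ≤ 1 ∧
      (meanOffspring ν ^ (q + 1))⁻¹ ≤ ε := by
  have hla : 0 < Real.log (meanOffspring ν) := Real.log_pos ha
  have ha0 : 0 < meanOffspring ν := by linarith
  have hγ : 0 < threshold ν ε :=
    div_pos (Real.log_pos (by rw [lt_div_iff₀ hε0]; linarith)) hla
  have hγε : threshold ν ε * Real.log (meanOffspring ν) = -Real.log ε := by
    rw [threshold, div_mul_cancel₀ _ hla.ne', one_div, Real.log_inv]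
  have hceil : 0 < ⌈threshold ν ε⌉₊ := Nat.ceil_pos.2 hγ
  obtain ⟨q, hq⟩ : ∃ q, ⌈threshold ν ε⌉₊ = q + 1 := ⟨⌈threshold ν ε⌉₊ - 1, by omega⟩
  have h1 : (q : ℝ) < threshold ν ε := Nat.lt_ceil.1 (by omega)
  have h2 : threshold ν ε ≤ q + 1 := by
    have := Nat.le_ceil (threshold ν ε)
    rw [hq] at this
    exact_mod_cast this
  refine ⟨q, h1, h2, ?_, ?_⟩
  · rw [← Real.log_nonpos_iff (by positivity), Real.log_mul (by positivity) hε0.ne', Real.log_pow]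
    nlinarith
  · rw [← Real.log_le_log_iff (by positivity) hε0, Real.log_inv, Real.log_pow]
    push_cast
    nlinarith

namespace IsBranching

variable {Ω : Type*} [MeasurableSpace Ω] {P : Measure Ω} [IsProbabilityMeasure P] {ν : Measure ℕ}
  [IsProbabilityMeasure ν] {ξ : ℕ → ℕ → Ω → ℕ}

/-- The conditional deviation probability is bounded away from `1` and geometrically small. -/
lemma exists_measureReal_deviation_le (h : IsBranching P ν ξ) :
    ∃ δ B : ℝ, 0 < δ ∧ 0 < B ∧ ∀ ε x : ℝ, 0 < ε → ε < 1 → 1 ≤ x →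
      0 < P.real {ω | martingaleLimit ν ξ ω < ε} ∧
      P.real ({ω | martingaleLimit ν ξ ω < ε} ∩
          {ω | x ≤ |(branchTime ν ξ ω : ℝ) - threshold ν ε|}) ≤
        min (1 - δ) (B * ν.real {1} ^ ⌈x⌉₊) * P.real {ω | martingaleLimit ν ξ ω < ε} := by
  obtain ⟨C, hC, hL⟩ := h.exists_laplace_pow_le
  obtain ⟨c, hc, hlow⟩ := h.exists_le_measureReal_branchesAt
  obtain ⟨hp0, hp1⟩ := h.mass_one_mem
  set p := ν.real {1} with hp
  have hp1' : 0 < 1 - p := by linarith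
  set E := Real.exp 1 * C ^ 2 * (p ^ 2)⁻¹ * (1 - p)⁻¹ with hE
  have hE0 : 0 < E := by positivity
  refine ⟨c / (Real.exp 1 * C), (E + p⁻¹) / c, by positivity, by positivity,
    fun ε x hε0 hε1 hx => ?_⟩
  obtain ⟨q, hq1, hq2, hq3, hq4⟩ := exists_threshold_mem h.one_lt_mean hε0 hε1
  set S := {ω | martingaleLimit ν ξ ω < ε} with hS_def
  set T := {ω | x ≤ |(branchTime ν ξ ω : ℝ) - threshold ν ε|} with hT_def
  have hD : MeasurableSet (branchesAt ξ q) :=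
    (history h.meas).le _ _ (h.measurableSet_branchesAt q)
  have hlow' := hlow q ε hq4
  have hup := h.measureReal_lt_le_pow hL hq3
  have hcq : c * p ^ q ≤ P.real S := hlow'.trans (measureReal_mono Set.inter_subset_left)
  refine ⟨lt_of_lt_of_le (by positivity) hcq, ?_⟩
  rw [min_mul_of_nonneg _ _ measureReal_nonneg]
  refine le_min ?_ ?_
  · have hsub : S ∩ T ⊆ S \ branchesAt ξ q := by
      rintro ω ⟨hωS, hωT⟩
      refine ⟨hωS, fun hω => ?_⟩
      have h1 : x ≤ |(branchTime ν ξ ω : ℝ) - threshold ν ε| := hωT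
      rw [h.branchTime_eq hω, abs_of_nonneg (by push_cast; linarith)] at h1
      push_cast at h1
      linarith
    have h1 := measureReal_inter_add_sdiff (μ := P) (s := S) hD
    have h2 : P.real (S ∩ T) ≤ P.real (S \ branchesAt ξ q) := measureReal_mono hsub
    have h3 : c / (Real.exp 1 * C) * P.real S ≤ c * p ^ q := by
      rw [div_mul_eq_mul_div, div_le_iff₀ (by positivity)]
      nlinarith
    linarith
  · have hr : 1 ≤ ⌈x⌉₊ := Nat.one_le_ceil_iff.2 (by linarith)
    have hae : (S ∩ T : Set Ω) ≤ᵐ[P] ((S ∩ ⋃ i ∈ Finset.Icc ⌈x⌉₊ q, branchesAt ξ (q - i)) ∪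
        unbranchedUntil ξ (q + (⌈x⌉₊ - 1)) : Set Ω) := by
      filter_upwards [h.ae_exists_mem_branchesAt] with ω hω hST
      rcases h.mem_early_or_late hq1 hq2 hx hω hST.2 with h1 | h1
      · exact Or.inl ⟨hST.1, h1⟩
      · exact Or.inr h1
    have h1 : P.real (S ∩ T) ≤ E * (p ^ q * p ^ ⌈x⌉₊) + p ^ (q + (⌈x⌉₊ - 1)) := by
      refine (ENNReal.toReal_mono (measure_ne_top _ _) (measure_mono_ae hae)).trans
        ((measureReal_union_le _ _).trans ?_)
      exact add_le_add (h.measureReal_early_le hL hr hq3) (h.measureReal_unbranchedUntil _).le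
    have h2 : p ^ (q + (⌈x⌉₊ - 1)) = p⁻¹ * (p ^ q * p ^ ⌈x⌉₊) := by
      obtain ⟨m, hm⟩ : ∃ m, ⌈x⌉₊ = m + 1 := ⟨⌈x⌉₊ - 1, by omega⟩
      rw [hm, Nat.add_sub_cancel]
      field_simp
      ring
    calc P.real (S ∩ T) ≤ (E + p⁻¹) / c * p ^ ⌈x⌉₊ * (c * p ^ q) := by
          rw [h2] at h1
          refine h1.trans (le_of_eq ?_)
          field_simp
      _ ≤ (E + p⁻¹) / c * p ^ ⌈x⌉₊ * P.real S := by gcongr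

end IsBranching

/-- A bound which is both geometric and bounded away from `1` is at most `exp (-lam x)`, without a
constant in front. -/
lemma exists_min_le_exp {δ B p : ℝ} (hδ : 0 < δ) (hB : 0 < B) (hp0 : 0 < p) (hp1 : p < 1) :
    ∃ lam : ℝ, 0 < lam ∧ ∀ x : ℝ, 1 ≤ x → min (1 - δ) (B * p ^ ⌈x⌉₊) ≤ Real.exp (-lam * x) := by
  set κ := -Real.log p with hκ_def
  have hκ : 0 < κ := neg_pos.2 (Real.log_neg hp0 hp1)
  set X := max 1 (2 * Real.log B / κ) with hX_def
  have hX : 0 < X := lt_of_lt_of_le one_pos (le_max_left _ _)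
  refine ⟨min (δ / X) (κ / 2), lt_min (by positivity) (by positivity), fun x hx => ?_⟩
  have hx0 : 0 < x := by linarith
  -- Up to `X` the bound `1 - δ ≤ exp (-δ)` suffices; beyond `X` half of the rate absorbs `B`.
  rcases le_total x X with hxX | hXx
  · refine (min_le_left _ _).trans ((Real.one_sub_le_exp_neg δ).trans (Real.exp_le_exp.2 ?_))
    have h1 : min (δ / X) (κ / 2) * x ≤ δ / X * X :=
      mul_le_mul (min_le_left _ _) hxX hx0.le (by positivity)
    rw [div_mul_cancel₀ _ hX.ne'] at h1
    linarith
  · refine (min_le_right _ _).trans ?_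
    have h1 : p ^ ⌈x⌉₊ ≤ Real.exp (-κ * x) := by
      rw [← Real.log_le_iff_le_exp (by positivity), Real.log_pow]
      have := Nat.le_ceil x
      rw [hκ_def] at *
      nlinarith
    have h2 : B ≤ Real.exp (κ / 2 * x) := by
      rw [← Real.log_le_iff_le_exp hB]
      have := (le_max_right 1 (2 * Real.log B / κ)).trans hXx
      rw [div_le_iff₀ hκ] at this
      linarith
    calc B * p ^ ⌈x⌉₊ ≤ Real.exp (κ / 2 * x) * Real.exp (-κ * x) := by gcongr
      _ = Real.exp (-(κ / 2) * x) := by rw [← Real.exp_add]; ring_nf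
      _ ≤ _ := Real.exp_le_exp.2 (by
        have := mul_le_mul_of_nonneg_right (min_le_right (δ / X) (κ / 2)) hx0.le
        linarith)

end GaltonWatson

theorem proposition1 {Ω : Type*} [MeasurableSpace Ω] (P : Measure Ω) [IsProbabilityMeasure P]
    (ν : Measure ℕ) [IsProbabilityMeasure ν]
    (ξ : ℕ → ℕ → Ω → ℕ)
    (hξ_meas : ∀ n i, Measurable (ξ n i))
    (hξ_law : ∀ n i, P.map (ξ n i) = ν)
    (hξ_indep : iIndepFun (fun q : ℕ × ℕ => ξ q.1 q.2) P)
    (hν_zero : ν {0} = 0)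
    (hν_nondeg : ∀ k : ℕ, ν ≠ Measure.dirac k)
    (hν_log : Integrable (fun n : ℕ => (n : ℝ) * Real.log n) ν)
    (hν_min : GaltonWatson.minOffspring ν = 1) :
    (∀ᵐ ω ∂P,
      Tendsto (fun n : ℕ => (GaltonWatson.genSize ξ n ω : ℝ) / GaltonWatson.meanOffspring ν ^ n)
          atTop (𝓝 (GaltonWatson.martingaleLimit ν ξ ω)) ∧
        0 < GaltonWatson.martingaleLimit ν ξ ω ∧
        ∃ k : ℕ, GaltonWatson.minOffspring ν ^ k < GaltonWatson.genSize ξ k ω) ∧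
    (∀ ε : ℝ, 0 < ε → 0 < P {ω | GaltonWatson.martingaleLimit ν ξ ω < ε}) ∧
    ∃ lam : ℝ, 0 < lam ∧ ∀ x : ℝ, 1 ≤ x →
      limsup (fun ε : ℝ =>
          (ProbabilityTheory.cond P {ω | GaltonWatson.martingaleLimit ν ξ ω < ε})
            {ω | x ≤ |(GaltonWatson.branchTime ν ξ ω : ℝ) - GaltonWatson.threshold ν ε|})
        (𝓝[>] 0) ≤ ENNReal.ofReal (Real.exp (-lam * x)) := by
  have h : GaltonWatson.IsBranching P ν ξ :=
    ⟨hξ_meas, hξ_law, hξ_indep, hν_zero, hν_nondeg, hν_log, hν_min⟩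
  obtain ⟨δ, B, hδ, hB, hdev⟩ := h.exists_measureReal_deviation_le
  obtain ⟨lam, hlam, hexp⟩ := GaltonWatson.exists_min_le_exp hδ hB h.mass_one_mem.1
    h.mass_one_mem.2
  refine ⟨?_, fun ε hε => ?_, lam, hlam, fun x hx => ?_⟩
  · filter_upwards [h.ae_tendsto_martingaleLimit, h.ae_martingaleLimit_pos,
      h.ae_exists_branching] with ω h1 h2 h3
    refine ⟨h1, h2, ?_⟩
    simpa only [hν_min, one_pow] using h3
  · have h1 := (hdev (min ε (1 / 2)) 1 (lt_min hε (by norm_num))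
      ((min_le_right _ _).trans_lt (by norm_num)) le_rfl).1
    refine (ENNReal.toReal_pos_iff.1 h1).1.trans_le (measure_mono fun ω hω => ?_)
    have hω' : GaltonWatson.martingaleLimit ν ξ ω < min ε (1 / 2) := hω
    exact lt_of_lt_of_le hω' (min_le_left _ _)
  · refine limsup_le_of_le (by isBoundedDefault) ?_
    filter_upwards [Ioo_mem_nhdsGT (zero_lt_one (α := ℝ))] with ε hε
    obtain ⟨hpos, hle⟩ := hdev ε x hε.1 hε.2 hx
    have hS : MeasurableSet {ω | GaltonWatson.martingaleLimit ν ξ ω < ε} :=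
      measurableSet_lt h.measurable_martingaleLimit measurable_const
    refine (ENNReal.le_ofReal_iff_toReal_le (measure_ne_top _ _) (Real.exp_pos _).le).2 ?_
    rw [cond_apply hS, ENNReal.toReal_mul, ENNReal.toReal_inv]
    refine (inv_mul_le_iff₀ hpos).2 (hle.trans ?_)
    rw [mul_comm]
    exact mul_le_mul_of_nonneg_left (hexp x hx) hpos.le
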